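/- **Setting.** Let $\Gamma=\{(\xi,\eta):\xi,\eta\ge 0,\ \xi+\eta\le 1\}$ with vertices $v_1=(0,0)$, $v_2=(0,1)$, $v_3=(1,0)$ and edges $e_{12},e_{13},e_{23}$, where $e_{ij}$ is oriented from $v_i$ to $v_j$ and parametrized by $s\mapsto(1-s)v_i+s v_j$, $s\in[0,1]$. The tangential trace of a vector field $\vartheta$ on $e_{ij}$ is $\langle v_j-v_i,\vartheta\rangle|_{e_{ij}}$. For $q\ge1$, an *$H^1$-conforming polytopal basis* of $U^q(\Gamma)$ consists of linearly independent polynomials of degree at most $q$: one vertex function for each vertex (spanning $\mathcal V^q_i$), $q-1$ edge functions for each edge (spanning $\mathcal E^q_{ij}$), and $(q-1)(q-2)/2$ cell functions (spanning $\mathcal C^q_{123}$). A vertex function vanishes at the other vertices and on the opposite edge, an edge function vanishes on the other two edges, and a cell function vanishes on $\partial\Gamma$. Moreover the traces match across interfaces: as functions of $s$, the traces of the $k$-th edge functions of the three edges on their own edges coincide, and on all three edges the traces of the vertex functions of the first endpoint coincide, as do those of the second endpoint. Let $p\ge0$. Take such a basis of $U^{p+1}(\Gamma)$ and, if $p\ge1$,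 one of $U^p(\Gamma)$. Put $$\vartheta^I_1=(\eta,\,1-\xi)^T,\qquad \vartheta^I_2=(1-\eta,\,\xi)^T,\qquad \vartheta^I_3=(\eta,\,-\xi)^T .$$ The base functions of the triangle element $\mathcal N_I^p$ are: * edge functions of $e_{12},e_{13},e_{23}$: respectively $\vartheta^I_1,\vartheta^I_2,\vartheta^I_3$, together with the gradients $\nabla n$ of the edge functions $n$ of $U^{p+1}$ on that edge; * cell functions: the gradients $\nabla n$ of the cell functions $n$ of $U^{p+1}$ and, if $p\ge1$, the template products $n\,\vartheta^I_3$ and $n\,\vartheta^I_2$ with $n$ the vertex function of $U^p$ at $v_1$ and at $v_2$ respectively, $n(\vartheta_3^I-\vartheta_2^I)$, $n(\vartheta_1^I+\vartheta_3^I)$, $n(\vartheta_1^I-\vartheta_2^I)$ with $n$ an edge function of $U^p$ on $e_{12}$, $e_{13}$, $e_{23}$ respectively, and $n(\vartheta_1^I-\vartheta_2^I+\vartheta_3^I)$ with $n$ a cell function of $U^p$. A *conforming triangulation* is a finite family of maps $F_K:\mathbb R^2\to\mathbb R^2$ that are $C^1$ near every point of $\Gamma$ with Jacobi matrix $J_K$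 invertible on $\Gamma$, and injective on $\Gamma$ (affine maps are a special case), with globally numbered vertices, such that distinct elements $F_K(\Gamma)$ have distinct vertex sets, any two of them intersect exactly in the face (empty, a vertex or an edge) spanned by their common vertices, the two parametrizations agree on that face (equal barycentric coordinates with respect to the common vertices), and a common edge has the same orientation in both elements. Let $A$ be the interior of $\bigcup_K F_K(\Gamma)$. A reference field $\vartheta$ is mapped to the element by the covariant Piola transformation $\theta(F_K(x))=J_K(x)^{-T}\vartheta(x)$. The global edge function of an edge of the triangulation is, on each element containing that edge, the Piola image of the corresponding local edge function, and zero on all other elements; a global cell function is the Piola image of a cell function on one element and zero elsewhere. The finite element space is the linear span of all global edge and cell functions (values on the interfaces are irrelevant). **Theorem.** The tangential trace of every cell function of $\mathcal N_I^p$, in particular of every template product, vanishes on all three edges of $\Gamma$. For every conforming triangulation, the finite element space obtained by covariant Piola transformations is contained in $$H(\mathrm{curl},A)=\{u\in[L^2(A)]^2:\ \partial_x u_2-\partial_y u_1\in L^2(A)\ \text{in the weak sense}\};$$ that is, the element is $H(\mathrm{curl})$-conforming. -/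

import Mathlib

noncomputable section

namespace PolytopalTemplate

/-- The plane. Its volume is two-dimensional Lebesgue measure; its norm is never used. -/
abbrev Plane : Type := Fin 2 → ℝ

/-! ### The reference triangle -/

/-- The closed reference triangle. -/
def refTriangle : Set Plane := {x | 0 ≤ x 0 ∧ 0 ≤ x 1 ∧ x 0 + x 1 ≤ 1}

/-- The vertices `v₁ = (0,0)`, `v₂ = (0,1)`, `v₃ = (1,0)`, with indices `0, 1, 2`. -/
def refVertex : Fin 3 → Plane := ![![0, 0], ![0, 1], ![1, 0]]

/-- Barycentric coordinates with respect to `v₁, v₂, v₃`. -/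
def bary (x : Plane) : Fin 3 → ℝ := ![1 - x 0 - x 1, x 1, x 0]

/-- First vertex of the edges `e₁₂, e₁₃, e₂₃`, which have indices `0, 1, 2`. -/
def edgeStart : Fin 3 → Fin 3 := ![0, 0, 1]

/-- Second vertex of the edges `e₁₂, e₁₃, e₂₃`. -/
def edgeEnd : Fin 3 → Fin 3 := ![1, 2, 2]

/-- Parametrization over `[0,1]` of an edge, from its first to its second vertex. -/
def edgePoint (j : Fin 3) (s : ℝ) : Plane :=
  (1 - s) • refVertex (edgeStart j) + s • refVertex (edgeEnd j)

/-- Tangent vector of an edge (pointing from its first to its second vertex). -/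
def edgeTangent (j : Fin 3) : Plane := refVertex (edgeEnd j) - refVertex (edgeStart j)

/-- Tangential trace of a vector field on an edge. -/
def tangentialTrace (f : Plane → Plane) (j : Fin 3) (s : ℝ) : ℝ :=
  ∑ i, edgeTangent j i * f (edgePoint j s) i

/-! ### The underlying scalar spaces -/

/-- Polynomials in the two reference coordinates. -/
abbrev Poly : Type := MvPolynomial (Fin 2) ℝ

/-- Trace of a scalar polynomial on an edge of the reference triangle. -/
def edgeTrace (n : Poly) (j : Fin 3) (s : ℝ) : ℝ := MvPolynomial.eval (edgePoint j s) n

/-- A polytopal basis, conforming in `H¹`, of a polynomial space `U^p` (`p ≥ 1`) on the reference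
triangle: one base function for each vertex, `p - 1` for each edge and `(p - 1)(p - 2) / 2` for
the cell. -/
structure PolytopalBasis (p : ℕ) where
  vertex : Fin 3 → Poly
  edge : Fin 3 → Fin (p - 1) → Poly
  cell : Fin ((p - 1) * (p - 2) / 2) → Poly
  vertex_degree : ∀ i, (vertex i).totalDegree ≤ p
  edge_degree : ∀ j k, (edge j k).totalDegree ≤ p
  cell_degree : ∀ k, (cell k).totalDegree ≤ p
  linearIndependent : LinearIndependent ℝ
    (Sum.elim vertex (Sum.elim (fun jk : Fin 3 × Fin (p - 1) => edge jk.1 jk.2) cell))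
  /-- Vertex base functions vanish on the other vertices. -/
  vertex_vertex : ∀ i i', i ≠ i' → MvPolynomial.eval (refVertex i') (vertex i) = 0
  /-- Vertex base functions vanish on the edges that do not contain the vertex. -/
  vertex_edge : ∀ i j, i ≠ edgeStart j → i ≠ edgeEnd j →
    ∀ s ∈ Set.Icc (0 : ℝ) 1, edgeTrace (vertex i) j s = 0
  /-- Edge base functions vanish on the other edges. -/
  edge_edge : ∀ i j k, i ≠ j → ∀ s ∈ Set.Icc (0 : ℝ) 1, edgeTrace (edge i k) j s = 0
  /-- Cell base functions vanish on the whole boundary. -/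
  cell_edge : ∀ k j, ∀ s ∈ Set.Icc (0 : ℝ) 1, edgeTrace (cell k) j s = 0
  /-- No jump across an interface: whichever two local edges are glued (with their
  orientations), the base functions of the first vertex have equal traces, -/
  vertex_start_trace : ∀ j j', ∀ s ∈ Set.Icc (0 : ℝ) 1,
    edgeTrace (vertex (edgeStart j)) j s = edgeTrace (vertex (edgeStart j')) j' s
  /-- so have those of the second vertex, -/
  vertex_end_trace : ∀ j j', ∀ s ∈ Set.Icc (0 : ℝ) 1,
    edgeTrace (vertex (edgeEnd j)) j s = edgeTrace (vertex (edgeEnd j')) j' s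
  /-- and so have corresponding edge base functions. -/
  edge_trace : ∀ j j' k, ∀ s ∈ Set.Icc (0 : ℝ) 1,
    edgeTrace (edge j k) j s = edgeTrace (edge j' k) j' s

/-! ### Base functions of the Nédélec element of the first type -/

/-- The lowest order Nédélec base functions `ϑ₁, ϑ₂, ϑ₃`, belonging to `e₁₂, e₁₃, e₂₃`. -/
def lowest : Fin 3 → Plane → Plane :=
  ![fun x => ![x 1, 1 - x 0], fun x => ![1 - x 1, x 0], fun x => ![x 1, -x 0]]

/-- Template of the vertices `v₁, v₂`. -/
def vertexTemplate : Fin 2 → Plane → Plane := ![lowest 2, lowest 1]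

/-- Template of the edges `e₁₂, e₁₃, e₂₃`. -/
def edgeTemplate : Fin 3 → Plane → Plane :=
  ![lowest 2 - lowest 1, lowest 0 + lowest 2, lowest 0 - lowest 1]

/-- Template of the cell. -/
def cellTemplate : Plane → Plane := lowest 0 - lowest 1 + lowest 2

/-- Gradient of a polynomial, as a vector field. -/
def grad (n : Poly) : Plane → Plane := fun x i => MvPolynomial.eval x (MvPolynomial.pderiv i n)

/-- Product of a scalar base function with a template vector field. -/
def templateProduct (n : Poly) (f : Plane → Plane) : Plane → Plane :=
  fun x => MvPolynomial.eval x n • f x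

variable {p : ℕ}

/-- The edge base functions of `N_I^p` on the edge `j`: the lowest order function (`none`) and the
gradients of the edge base functions of `U^{p+1}` (`some k`). -/
def edgeField (B : PolytopalBasis (p + 1)) (j : Fin 3) : Option (Fin (p + 1 - 1)) → Plane → Plane
  | none => lowest j
  | some k => grad (B.edge j k)

/-- The template products (vertex-cell, edge-cell and cell) of `U^p` for `p ≥ 1`. -/
def templateFields (C : PolytopalBasis p) : Set (Plane → Plane) :=
  (Set.range fun i : Fin 2 => templateProduct (C.vertex i.castSucc) (vertexTemplate i)) ∪
  (Set.range fun jk : Fin 3 × Fin (p - 1) =>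
    templateProduct (C.edge jk.1 jk.2) (edgeTemplate jk.1)) ∪
  (Set.range fun k => templateProduct (C.cell k) cellTemplate)

/-- The cell base functions of `N_I^p`: the gradients of the cell base functions of `U^{p+1}` and,
unless `p = 0`, the template products of `U^p`. -/
def cellFields (B : PolytopalBasis (p + 1)) (C : 0 < p → PolytopalBasis p) : Set (Plane → Plane) :=
  (Set.range fun k => grad (B.cell k)) ∪ {f | ∃ hp : 0 < p, f ∈ templateFields (C hp)}

/-! ### Covariant Piola transformation -/

/-- Jacobi matrix. -/
def jacobian (F : Plane → Plane) (x : Plane) : Matrix (Fin 2) (Fin 2) ℝ :=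
  Matrix.of fun i j => fderiv ℝ F x (Pi.single j 1) i

/-- Covariant Piola transform `θ = J⁻ᵀ ϑ` of a reference field `ϑ` under the element map `F`, on
the open element; it is extended by zero to the plane. -/
def piola (F : Plane → Plane) (f : Plane → Plane) : Plane → Plane :=
  (F '' interior refTriangle).indicator fun y =>
    ((jacobian F (Function.invFunOn F refTriangle y))⁻¹).transpose.mulVec
      (f (Function.invFunOn F refTriangle y))

/-! ### Triangulations -/

/-- Global barycentric coordinates: the local coordinate of `x` at the vertex number `n`, if
`n` is a vertex of the element, and zero otherwise. -/
def globalBary (v : Fin 3 → ℕ) (x : Plane) (n : ℕ) : ℝ :=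
  ∑ i, if v i = n then bary x i else 0

/-- A conforming triangulation with (possibly curved) elements indexed by `ι`. Element `K` is the
image of the reference triangle under `map K`; its local vertices have the global
numbers `vert K i`. -/
structure Mesh (ι : Type*) where
  vert : ι → Fin 3 → ℕ
  map : ι → Plane → Plane
  vert_injective : ∀ K, Function.Injective (vert K)
  /-- Distinct elements have distinct vertex sets. -/
  eq_of_range : ∀ K L, Set.range (vert K) = Set.range (vert L) → K = L
  /-- A common edge of two elements has the same orientation in both. -/
  oriented : ∀ K L i j k l, vert K i = vert L k → vert K j = vert L l → i < j → k < l
  contDiffAt : ∀ K, ∀ x ∈ refTriangle, ContDiffAt ℝ 1 (map K) x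
  det_ne_zero : ∀ K, ∀ x ∈ refTriangle, (jacobian (map K) x).det ≠ 0
  /-- Element maps are injective, two elements meet exactly in the face (common vertex or
  edge) spanned by their common vertices, and their parametrizations agree there. -/
  conforming : ∀ K L, ∀ x ∈ refTriangle, ∀ y ∈ refTriangle,
    map K x = map L y ↔ ∀ n, globalBary (vert K) x n = globalBary (vert L) y n

variable {ι : Type*}

/-- The domain that is triangulated. -/
def Mesh.domain (M : Mesh ι) : Set Plane := interior (⋃ K, M.map K '' refTriangle)

/-- The global edge base function with label `κ` of the edge from vertex number `n` to vertex
number `m`: on every element that has this edge, the Piola transform of the base function `κ` of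
the corresponding local edge; zero on the other elements. -/
def Mesh.edgeFunction [Fintype ι] (M : Mesh ι) (B : PolytopalBasis (p + 1)) (n m : ℕ)
    (κ : Option (Fin (p + 1 - 1))) : Plane → Plane :=
  ∑ K, ∑ j, if M.vert K (edgeStart j) = n ∧ M.vert K (edgeEnd j) = m
    then piola (M.map K) (edgeField B j κ) else 0

/-- The `N_I^p` finite element space on a mesh: the span of the global edge base functions and of
the Piola transforms of the cell base functions. -/
def Mesh.nedelecI [Fintype ι] (M : Mesh ι) (B : PolytopalBasis (p + 1))
    (C : 0 < p → PolytopalBasis p) : Submodule ℝ (Plane → Plane) :=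
  Submodule.span ℝ ({u | ∃ n m κ, u = M.edgeFunction B n m κ} ∪
    {u | ∃ K, ∃ f ∈ cellFields B C, u = piola (M.map K) f})

/-! ### The space `H(curl, A)` -/

/-- `w` is the weak (distributional) curl `∂₁u₂ - ∂₂u₁` of `u` on the open set `A`. -/
def IsWeakCurl (A : Set Plane) (u : Plane → Plane) (w : Plane → ℝ) : Prop :=
  ∀ φ : Plane → ℝ, ContDiff ℝ (⊤ : ℕ∞) φ → HasCompactSupport φ → tsupport φ ⊆ A →
    ∫ x in A, w x * φ x =
      ∫ x in A, (u x 0 * fderiv ℝ φ x (Pi.single 1 1) - u x 1 * fderiv ℝ φ x (Pi.single 0 1))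

/-- Membership in `H(curl, A)`: `u` is in `[L²(A)]²` and has a weak curl in `L²(A)`. -/
def MemHcurl (A : Set Plane) (u : Plane → Plane) : Prop :=
  (∀ i, MeasureTheory.MemLp (fun x => u x i) 2 (MeasureTheory.volume.restrict A)) ∧
  ∃ w : Plane → ℝ, MeasureTheory.MemLp w 2 (MeasureTheory.volume.restrict A) ∧ IsWeakCurl A u w

end PolytopalTemplate

end

noncomputable section

namespace PolytopalTemplate

open MeasureTheory Set Filter Topology

/-! ### The reference triangle and its edges -/

/-! A field that is smooth on each element lies in `H(curl)` once the boundary terms of elementwise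
integration by parts cancel; the elementwise curl is then the weak curl. The covariant Piola
transformation suits this because `∇(φ ∘ F) = Jᵀ ∇φ`, so the factor `J⁻ᵀ` cancels in the pairing
with a test function and everything returns to the reference triangle, up to the constant sign of
`det J`. No derivative of `J` appears, so `C¹` element maps suffice. The result is
`IsElementMap.integral_piolaCurl`: the error term is a signed sum, over the three reference edges,
of integrals of `φ ∘ F` against the tangential trace.

For cell functions these traces vanish. A gradient has as its tangential trace the derivative of the
scalar trace, which is zero; in a template product, on each edge either the scalar factor or the
template has zero trace (`tangentialTrace_of_mem_templateFields`).

For a global edge function only the edge itself contributes. Its integral has the same value from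
every element having that edge, since parametrizations and traces match, so only the signs matter.
Here geometry enters: the sign records the side of the edge on which the element lies. At most one
element lies on each side (`Mesh.HasEdge.eq_of_sign`), and an edge with an inner point in the domain
has elements on both sides (`Mesh.HasEdge.exists_neg_sign`). So either two equal terms of opposite
sign cancel, or the test function vanishes along the open edge. -/

theorem edgePoint_zero (s : ℝ) : edgePoint 0 s = ![0, s] := by
  ext i; fin_cases i <;> simp [edgePoint, refVertex, edgeStart, edgeEnd]

theorem edgePoint_one (s : ℝ) : edgePoint 1 s = ![s, 0] := by
  ext i; fin_cases i <;> simp [edgePoint, refVertex, edgeStart, edgeEnd]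

theorem edgePoint_two (s : ℝ) : edgePoint 2 s = ![s, 1 - s] := by
  ext i; fin_cases i <;> simp [edgePoint, refVertex, edgeStart, edgeEnd]

theorem edgeTangent_zero : edgeTangent 0 = ![0, 1] := by
  ext i; fin_cases i <;> simp [edgeTangent, refVertex, edgeStart, edgeEnd]

theorem edgeTangent_one : edgeTangent 1 = ![1, 0] := by
  ext i; fin_cases i <;> simp [edgeTangent, refVertex, edgeStart, edgeEnd]

theorem edgeTangent_two : edgeTangent 2 = ![1, -1] := by
  ext i; fin_cases i <;> simp [edgeTangent, refVertex, edgeStart, edgeEnd]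

theorem tangentialTrace_zero (f : Plane → Plane) (s : ℝ) :
    tangentialTrace f 0 s = f ![0, s] 1 := by
  simp [tangentialTrace, edgePoint_zero, edgeTangent_zero]

theorem tangentialTrace_one (f : Plane → Plane) (s : ℝ) :
    tangentialTrace f 1 s = f ![s, 0] 0 := by
  simp [tangentialTrace, edgePoint_one, edgeTangent_one]

theorem tangentialTrace_two (f : Plane → Plane) (s : ℝ) :
    tangentialTrace f 2 s = f ![s, 1 - s] 0 - f ![s, 1 - s] 1 := by
  simp [tangentialTrace, edgePoint_two, edgeTangent_two, sub_eq_add_neg]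

theorem edgePoint_eq_lineMap (j : Fin 3) :
    edgePoint j = AffineMap.lineMap (refVertex (edgeStart j)) (refVertex (edgeEnd j)) := by
  ext s i; simp [edgePoint, AffineMap.lineMap_apply_module]

theorem hasDerivAt_edgePoint (j : Fin 3) (s : ℝ) :
    HasDerivAt (edgePoint j) (edgeTangent j) s := by
  rw [edgePoint_eq_lineMap]
  simpa [edgeTangent] using (AffineMap.hasDerivAt_lineMap
    (a := refVertex (edgeStart j)) (b := refVertex (edgeEnd j)) (x := s))

theorem continuous_edgePoint (j : Fin 3) : Continuous (edgePoint j) :=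
  continuous_iff_continuousAt.2 fun s => (hasDerivAt_edgePoint j s).continuousAt

theorem edgePoint_mem (j : Fin 3) {s : ℝ} (hs : s ∈ Icc (0 : ℝ) 1) :
    edgePoint j s ∈ refTriangle := by
  obtain ⟨h0, h1⟩ := hs
  fin_cases j
  · simpa [edgePoint_zero, refTriangle] using ⟨h0, h1⟩
  · simpa [edgePoint_one, refTriangle] using ⟨h0, h1⟩
  · simpa [edgePoint_two, refTriangle] using ⟨h0, h1⟩

theorem convex_refTriangle : Convex ℝ refTriangle := by
  intro x hx y hy a b ha hb hab
  obtain ⟨x0, x1, x2⟩ := hx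
  obtain ⟨y0, y1, y2⟩ := hy
  refine ⟨?_, ?_, ?_⟩ <;> simp only [Pi.add_apply, Pi.smul_apply, smul_eq_mul]
  · positivity
  · positivity
  · nlinarith [mul_le_mul_of_nonneg_left x2 ha, mul_le_mul_of_nonneg_left y2 hb]

theorem isClosed_refTriangle : IsClosed refTriangle := by
  have h0 : Continuous fun x : Plane => x 0 := continuous_apply 0
  have h1 : Continuous fun x : Plane => x 1 := continuous_apply 1
  exact (isClosed_le continuous_const h0).inter
    ((isClosed_le continuous_const h1).inter (isClosed_le (h0.add h1) continuous_const))

theorem isCompact_refTriangle : IsCompact refTriangle := by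
  refine (isCompact_Icc (a := (0 : Plane)) (b := 1)).of_isClosed_subset isClosed_refTriangle ?_
  rintro x ⟨h0, h1, h2⟩
  constructor <;> intro i <;> fin_cases i <;> simp <;> linarith

theorem interior_refTriangle_ae_eq :
    (interior refTriangle : Set Plane) =ᵐ[volume] refTriangle :=
  interior_ae_eq_of_null_frontier (convex_refTriangle.addHaar_frontier volume)

theorem bary_nonneg {x : Plane} (hx : x ∈ refTriangle) (i : Fin 3) : 0 ≤ bary x i := by
  obtain ⟨h0, h1, h2⟩ := hx
  fin_cases i <;> simp [bary] <;> linarith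

theorem mem_refTriangle_of_bary {x : Plane} (h : ∀ i, 0 ≤ bary x i) : x ∈ refTriangle := by
  have h0 := h 0
  have h1 := h 1
  have h2 := h 2
  simp [bary] at h0 h1 h2
  exact ⟨h2, h1, by linarith⟩

theorem continuous_bary (i : Fin 3) : Continuous fun x => bary x i := by
  fin_cases i <;> simp [bary] <;> fun_prop

/-! ### Integration over the reference triangle -/

theorem integrable_indicator_finTwoArrow {g : Plane → ℝ} (hg : ContinuousOn g refTriangle) :
    Integrable (fun z : ℝ × ℝ => refTriangle.indicator g ![z.1, z.2])
      ((volume : Measure ℝ).prod volume) := by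
  have h : Integrable (refTriangle.indicator g) (volume : Measure Plane) :=
    (hg.integrableOn_compact isCompact_refTriangle).integrable_indicator
      isClosed_refTriangle.measurableSet
  exact ((volume_preserving_finTwoArrow ℝ).symm.integrable_comp_emb
    (MeasurableEquiv.measurableEmbedding _)).2 h

theorem setIntegral_refTriangle_eq_prod (g : Plane → ℝ) :
    ∫ x in refTriangle, g x =
      ∫ z, refTriangle.indicator g ![z.1, z.2] ∂((volume : Measure ℝ).prod volume) := by
  rw [← integral_indicator isClosed_refTriangle.measurableSet]
  exact ((volume_preserving_finTwoArrow ℝ).symm.integral_comp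
    (MeasurableEquiv.measurableEmbedding _) _).symm

/-- The condition defining the triangle is symmetric in the two coordinates, so this one computation
of a slice serves both orders of integration. -/
theorem integral_slice {g : ℝ → ℝ} {k : ℝ → ℝ} {b : ℝ}
    (h : ∀ a, k a = if 0 ≤ a ∧ 0 ≤ b ∧ a + b ≤ 1 then g a else 0) :
    ∫ a, k a = (Icc (0 : ℝ) 1).indicator (fun b => ∫ a in (0 : ℝ)..(1 - b), g a) b := by
  by_cases hb : b ∈ Icc (0 : ℝ) 1
  · rw [indicator_of_mem hb, intervalIntegral.integral_of_le (by linarith [hb.2]),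
      ← integral_Icc_eq_integral_Ioc, ← integral_indicator measurableSet_Icc]
    congr 1
    ext a
    rw [h]
    by_cases ha : a ∈ Icc (0 : ℝ) (1 - b)
    · rw [indicator_of_mem ha, if_pos ⟨ha.1, hb.1, by linarith [ha.2]⟩]
    · rw [indicator_of_notMem ha, if_neg]
      rintro ⟨h1, h2, h3⟩
      exact ha ⟨h1, by linarith⟩
  · rw [indicator_of_notMem hb]
    have : k = 0 := by
      ext a
      rw [h, if_neg]
      · rfl
      · rintro ⟨h1, h2, h3⟩
        exact hb ⟨h2, by linarith⟩
    simp [this]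

theorem setIntegral_refTriangle_snd {g : Plane → ℝ} (hg : ContinuousOn g refTriangle) :
    ∫ x in refTriangle, g x = ∫ b in (0 : ℝ)..1, ∫ a in (0 : ℝ)..(1 - b), g ![a, b] := by
  rw [setIntegral_refTriangle_eq_prod, integral_prod_symm _ (integrable_indicator_finTwoArrow hg),
    intervalIntegral.integral_of_le zero_le_one, ← integral_Icc_eq_integral_Ioc,
    ← integral_indicator measurableSet_Icc]
  congr 1
  ext b
  exact integral_slice (g := fun a => g ![a, b]) fun a => by
    simp [indicator, refTriangle]

theorem setIntegral_refTriangle_fst {g : Plane → ℝ} (hg : ContinuousOn g refTriangle) :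
    ∫ x in refTriangle, g x = ∫ a in (0 : ℝ)..1, ∫ b in (0 : ℝ)..(1 - a), g ![a, b] := by
  rw [setIntegral_refTriangle_eq_prod, integral_prod _ (integrable_indicator_finTwoArrow hg),
    intervalIntegral.integral_of_le zero_le_one, ← integral_Icc_eq_integral_Ioc,
    ← integral_indicator measurableSet_Icc]
  congr 1
  ext a
  exact integral_slice (g := fun b => g ![a, b]) fun b => by
    simp only [indicator, refTriangle, mem_ofPred_eq, Matrix.cons_val_zero, Matrix.cons_val_one]
    congr 1
    rw [add_comm b a]
    exact propext ⟨fun ⟨h1, h2, h3⟩ => ⟨h2, h1, h3⟩, fun ⟨h1, h2, h3⟩ => ⟨h2, h1, h3⟩⟩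

theorem hasDerivAt_vec_fst (a b : ℝ) :
    HasDerivAt (fun a : ℝ => (![a, b] : Plane)) (Pi.single 0 1) a := by
  rw [hasDerivAt_pi]
  intro i
  fin_cases i
  · simpa using hasDerivAt_id' a
  · simpa using hasDerivAt_const a b

theorem hasDerivAt_vec_snd (a b : ℝ) :
    HasDerivAt (fun b : ℝ => (![a, b] : Plane)) (Pi.single 1 1) b := by
  rw [hasDerivAt_pi]
  intro i
  fin_cases i
  · simpa using hasDerivAt_const b a
  · simpa using hasDerivAt_id' b

theorem continuous_vec_fst (b : ℝ) : Continuous fun a : ℝ => (![a, b] : Plane) :=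
  continuous_iff_continuousAt.2 fun a => (hasDerivAt_vec_fst a b).continuousAt

theorem continuous_vec_snd (a : ℝ) : Continuous fun b : ℝ => (![a, b] : Plane) :=
  continuous_iff_continuousAt.2 fun b => (hasDerivAt_vec_snd a b).continuousAt

theorem setIntegral_partial_fst {h : Plane → ℝ} (hd : ∀ x ∈ refTriangle, DifferentiableAt ℝ h x)
    (hc : ContinuousOn (fun x => fderiv ℝ h x (Pi.single 0 1)) refTriangle) :
    ∫ x in refTriangle, fderiv ℝ h x (Pi.single 0 1) =
      ∫ b in (0 : ℝ)..1, (h ![1 - b, b] - h ![0, b]) := by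
  rw [setIntegral_refTriangle_snd hc]
  refine intervalIntegral.integral_congr fun b hb => ?_
  rw [uIcc_of_le zero_le_one] at hb
  have hmem : ∀ a ∈ uIcc 0 (1 - b), (![a, b] : Plane) ∈ refTriangle := fun a ha => by
    rw [uIcc_of_le (by linarith [hb.2])] at ha
    exact ⟨by simpa using ha.1, by simpa using hb.1, by simp; linarith [ha.2]⟩
  exact intervalIntegral.integral_eq_sub_of_hasDerivAt (f := fun a => h ![a, b])
    (fun a ha => (hd _ (hmem a ha)).hasFDerivAt.comp_hasDerivAt a (hasDerivAt_vec_fst a b))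
    (hc.comp (continuous_vec_fst b).continuousOn hmem).intervalIntegrable

theorem setIntegral_partial_snd {h : Plane → ℝ} (hd : ∀ x ∈ refTriangle, DifferentiableAt ℝ h x)
    (hc : ContinuousOn (fun x => fderiv ℝ h x (Pi.single 1 1)) refTriangle) :
    ∫ x in refTriangle, fderiv ℝ h x (Pi.single 1 1) =
      ∫ a in (0 : ℝ)..1, (h ![a, 1 - a] - h ![a, 0]) := by
  rw [setIntegral_refTriangle_fst hc]
  refine intervalIntegral.integral_congr fun a ha => ?_
  rw [uIcc_of_le zero_le_one] at ha
  have hmem : ∀ b ∈ uIcc 0 (1 - a), (![a, b] : Plane) ∈ refTriangle := fun b hb => by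
    rw [uIcc_of_le (by linarith [ha.2])] at hb
    exact ⟨by simpa using ha.1, by simpa using hb.1, by simp; linarith [hb.2]⟩
  exact intervalIntegral.integral_eq_sub_of_hasDerivAt (f := fun b => h ![a, b])
    (fun b hb => (hd _ (hmem b hb)).hasFDerivAt.comp_hasDerivAt b (hasDerivAt_vec_snd a b))
    (hc.comp (continuous_vec_snd a).continuousOn hmem).intervalIntegrable

/-- `1` if the orientation of the edge is that of the boundary of the reference triangle,
and `-1` otherwise. -/
def edgeSign : Fin 3 → ℝ := ![-1, 1, -1]

/-- The scalar curl `∂₁f₂ - ∂₂f₁`. -/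
def scalarCurl (f : Plane → Plane) (x : Plane) : ℝ :=
  fderiv ℝ (fun y => f y 1) x (Pi.single 0 1) - fderiv ℝ (fun y => f y 0) x (Pi.single 1 1)

theorem continuousOn_fderiv_apply {h : Plane → ℝ} (hh : ∀ x ∈ refTriangle, ContDiffAt ℝ 1 h x)
    (v : Plane) : ContinuousOn (fun x => fderiv ℝ h x v) refTriangle := fun x hx =>
  (((hh x hx).fderiv_right (m := 0) le_rfl).continuousAt.clm_apply
    continuousAt_const).continuousWithinAt

/-- Green's theorem on the reference triangle. -/
theorem setIntegral_scalarCurl {f : Plane → Plane}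
    (hf : ∀ x ∈ refTriangle, ∀ i, ContDiffAt ℝ 1 (fun y => f y i) x) :
    ∫ x in refTriangle, scalarCurl f x =
      ∑ j, edgeSign j * ∫ s in (0 : ℝ)..1, tangentialTrace f j s := by
  have hd : ∀ i, ∀ x ∈ refTriangle, DifferentiableAt ℝ (fun y => f y i) x := fun i x hx =>
    (hf x hx i).differentiableAt one_ne_zero
  have hc : ∀ i v, ContinuousOn (fun x => fderiv ℝ (fun y => f y i) x v) refTriangle := fun i v =>
    continuousOn_fderiv_apply (fun x hx => hf x hx i) v
  have hcf : ∀ i, ContinuousOn (fun y => f y i) refTriangle := fun i x hx =>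
    (hf x hx i).continuousAt.continuousWithinAt
  have hI : ∀ i v, IntegrableOn (fun x => fderiv ℝ (fun y => f y i) x v) refTriangle := fun i v =>
    (hc i v).integrableOn_compact isCompact_refTriangle
  have hint : ∀ i j, IntervalIntegrable (fun s => f (edgePoint j s) i) volume 0 1 := fun i j =>
    ((hcf i).comp (continuous_edgePoint j).continuousOn fun s hs => by
      rw [uIcc_of_le zero_le_one] at hs
      exact edgePoint_mem j hs).intervalIntegrable
  have h00 := hint 0 1
  have h02 := hint 0 2
  have h10 := hint 1 0
  have h12 := hint 1 2
  simp only [edgePoint_zero, edgePoint_one, edgePoint_two] at h00 h02 h10 h12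
  have h12' : IntervalIntegrable (fun s => f ![1 - s, s] 1) volume 0 1 := by
    simpa using (h12.comp_sub_left 1).symm
  simp only [scalarCurl, Fin.sum_univ_three, tangentialTrace_zero, tangentialTrace_one,
    tangentialTrace_two]
  rw [integral_sub (hI 1 _) (hI 0 _), setIntegral_partial_fst (hd 1) (hc 1 _),
    setIntegral_partial_snd (hd 0) (hc 0 _), intervalIntegral.integral_sub h12' h10,
    intervalIntegral.integral_sub h02 h00, intervalIntegral.integral_sub h02 h12]
  -- Integrating `∂₁` parametrizes the slanted edge by its second coordinate, but `edgePoint 2` uses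
  -- the first; the reflection `s ↦ 1 - s` reconciles them.
  have hr : ∫ s in (0 : ℝ)..1, f ![1 - s, s] 1 = ∫ s in (0 : ℝ)..1, f ![s, 1 - s] 1 := by
    have := intervalIntegral.integral_comp_sub_left (a := 0) (b := 1)
      (fun s : ℝ => f ![s, 1 - s] 1) 1
    simpa using this
  rw [hr]
  simp [edgeSign]
  ring

/-- Integration by parts for the curl on the reference triangle. -/
theorem setIntegral_curl_by_parts {f : Plane → Plane} {ψ : Plane → ℝ}
    (hf : ∀ x ∈ refTriangle, ∀ i, ContDiffAt ℝ 1 (fun y => f y i) x)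
    (hψ : ∀ x ∈ refTriangle, ContDiffAt ℝ 1 ψ x) :
    ∫ x in refTriangle,
        (f x 0 * fderiv ℝ ψ x (Pi.single 1 1) - f x 1 * fderiv ℝ ψ x (Pi.single 0 1)) =
      (∫ x in refTriangle, scalarCurl f x * ψ x) -
        ∑ j, edgeSign j * ∫ s in (0 : ℝ)..1, ψ (edgePoint j s) * tangentialTrace f j s := by
  have hcf : ∀ i, ContinuousOn (fun y => f y i) refTriangle := fun i x hx =>
    (hf x hx i).continuousAt.continuousWithinAt
  have hcψ : ContinuousOn ψ refTriangle := fun x hx => (hψ x hx).continuousAt.continuousWithinAt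
  have hdψ := continuousOn_fderiv_apply hψ
  have hdf : ∀ i v, ContinuousOn (fun x => fderiv ℝ (fun y => f y i) x v) refTriangle := fun i v =>
    continuousOn_fderiv_apply (fun x hx => hf x hx i) v
  -- Green's theorem for the product `ψ f`; the product rule for its curl yields both area
  -- integrals.
  have key := setIntegral_scalarCurl (f := fun x => ψ x • f x)
    (fun x hx i => (hψ x hx).mul (hf x hx i))
  have htr : ∀ j s, tangentialTrace (fun x => ψ x • f x) j s =
      ψ (edgePoint j s) * tangentialTrace f j s := fun j s => by
    simp only [tangentialTrace, Finset.mul_sum, Pi.smul_apply, smul_eq_mul]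
    exact Finset.sum_congr rfl fun i _ => by ring
  simp only [htr] at key
  rw [← key, ← integral_sub]
  · refine setIntegral_congr_fun isClosed_refTriangle.measurableSet fun x hx => ?_
    have hd : ∀ i, DifferentiableAt ℝ (fun y => f y i) x := fun i =>
      (hf x hx i).differentiableAt one_ne_zero
    have hdψ : DifferentiableAt ℝ ψ x := (hψ x hx).differentiableAt one_ne_zero
    simp only [scalarCurl, Pi.smul_apply, smul_eq_mul]
    rw [fderiv_fun_mul hdψ (hd 1), fderiv_fun_mul hdψ (hd 0)]
    simp only [_root_.add_apply, _root_.smul_apply, smul_eq_mul]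
    ring
  · exact (((hdf 1 _).sub (hdf 0 _)).mul hcψ).integrableOn_compact isCompact_refTriangle
  · have : ContinuousOn (scalarCurl fun x => ψ x • f x) refTriangle :=
      (continuousOn_fderiv_apply (fun x hx => (hψ x hx).mul (hf x hx 1)) _).sub
        (continuousOn_fderiv_apply (fun x hx => (hψ x hx).mul (hf x hx 0)) _)
    exact this.integrableOn_compact isCompact_refTriangle

/-! ### A single element -/

/-- The properties of the element maps of a mesh that do not involve other elements. -/
structure IsElementMap (F : Plane → Plane) : Prop where
  contDiffAt : ∀ x ∈ refTriangle, ContDiffAt ℝ 1 F x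
  det_ne_zero : ∀ x ∈ refTriangle, (jacobian F x).det ≠ 0
  injOn : InjOn F refTriangle

theorem jacobian_eq_toMatrix (F : Plane → Plane) (x : Plane) :
    jacobian F x = LinearMap.toMatrix' (fderiv ℝ F x : Plane →ₗ[ℝ] Plane) := by
  ext i j
  simp [jacobian, LinearMap.toMatrix'_apply]

theorem det_fderiv_eq (F : Plane → Plane) (x : Plane) :
    (fderiv ℝ F x).det = (jacobian F x).det := by
  rw [jacobian_eq_toMatrix, LinearMap.det_toMatrix']

/-- Sign of the Jacobi determinant at the first vertex. -/
def detSign (F : Plane → Plane) : ℝ := SignType.sign (jacobian F 0).det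

theorem zero_mem_refTriangle : (0 : Plane) ∈ refTriangle := by
  simp [refTriangle]

variable {F : Plane → Plane}

namespace IsElementMap

theorem continuousOn (hF : IsElementMap F) : ContinuousOn F refTriangle := fun x hx =>
  (hF.contDiffAt x hx).continuousAt.continuousWithinAt

theorem hasFDerivAt (hF : IsElementMap F) {x : Plane} (hx : x ∈ refTriangle) :
    HasFDerivAt F (fderiv ℝ F x) x :=
  ((hF.contDiffAt x hx).differentiableAt one_ne_zero).hasFDerivAt

theorem continuousOn_jacobian (hF : IsElementMap F) : ContinuousOn (jacobian F) refTriangle := by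
  refine continuousOn_pi.2 fun i => continuousOn_pi.2 fun j x hx => ?_
  have h := ((hF.contDiffAt x hx).fderiv_right (m := 0) le_rfl).continuousAt.clm_apply
    (continuousAt_const (y := (Pi.single j 1 : Plane)))
  exact ((continuous_apply i).continuousAt.comp h).continuousWithinAt

theorem continuousOn_det (hF : IsElementMap F) :
    ContinuousOn (fun x => (jacobian F x).det) refTriangle :=
  Continuous.comp_continuousOn (Continuous.matrix_det continuous_id) hF.continuousOn_jacobian

/-- The determinant is continuous without zeros on a connected set, so by the intermediate value
theorem it keeps the sign it has at the origin. -/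
theorem abs_det (hF : IsElementMap F) {x : Plane} (hx : x ∈ refTriangle) :
    |(jacobian F x).det| = detSign F * (jacobian F x).det := by
  have h0 := hF.det_ne_zero 0 zero_mem_refTriangle
  have hx0 := hF.det_ne_zero x hx
  have hpre := convex_refTriangle.isPreconnected
  rcases lt_or_gt_of_ne h0 with h | h <;> rcases lt_or_gt_of_ne hx0 with h' | h'
  · rw [detSign, sign_neg h, abs_of_neg h']
    simp
  · obtain ⟨y, hy, hy0⟩ := hpre.intermediate_value zero_mem_refTriangle hx hF.continuousOn_det
      ⟨h.le, h'.le⟩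
    exact absurd hy0 (hF.det_ne_zero y hy)
  · obtain ⟨y, hy, hy0⟩ := hpre.intermediate_value hx zero_mem_refTriangle hF.continuousOn_det
      ⟨h'.le, h.le⟩
    exact absurd hy0 (hF.det_ne_zero y hy)
  · rw [detSign, sign_pos h, abs_of_pos h']
    simp

theorem detSign_eq (hF : IsElementMap F) : detSign F = 1 ∨ detSign F = -1 := by
  rcases lt_or_gt_of_ne (hF.det_ne_zero 0 zero_mem_refTriangle) with h | h
  · right
    rw [detSign, sign_neg h]
    simp
  · left
    rw [detSign, sign_pos h]
    simp

theorem invFunOn_apply (hF : IsElementMap F) {x : Plane} (hx : x ∈ refTriangle) :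
    Function.invFunOn F refTriangle (F x) = x :=
  hF.injOn.leftInvOn_invFunOn hx

theorem isCompact_image (hF : IsElementMap F) : IsCompact (F '' refTriangle) :=
  isCompact_refTriangle.image_of_continuousOn hF.continuousOn

/-- A continuous injection on a compact set sends closed subsets to closed sets, so its inverse is
continuous. -/
theorem continuousOn_invFunOn (hF : IsElementMap F) :
    ContinuousOn (Function.invFunOn F refTriangle) (F '' refTriangle) := by
  rw [continuousOn_iff_isClosed]
  intro t ht
  refine ⟨F '' (refTriangle ∩ t), ?_, ?_⟩
  · exact ((isCompact_refTriangle.inter_right ht).image_of_continuousOn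
      (hF.continuousOn.mono inter_subset_left)).isClosed
  · ext y
    constructor
    · rintro ⟨hy, x, hx, rfl⟩
      rw [mem_preimage, hF.invFunOn_apply hx] at hy
      exact ⟨⟨x, ⟨hx, hy⟩, rfl⟩, x, hx, rfl⟩
    · rintro ⟨⟨x, ⟨hx, hxt⟩, rfl⟩, -⟩
      refine ⟨?_, x, hx, rfl⟩
      rwa [mem_preimage, hF.invFunOn_apply hx]

theorem measurableSet_image_interior (hF : IsElementMap F) :
    MeasurableSet (F '' interior refTriangle) :=
  isOpen_interior.measurableSet.image_of_continuousOn_injOn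
    (hF.continuousOn.mono interior_subset) (hF.injOn.mono interior_subset)

/-- The transported function is continuous on the compact closed element, hence bounded there, and
the element has finite measure. -/
theorem memLp_indicator (hF : IsElementMap F) {g : Plane → ℝ} (hg : ContinuousOn g refTriangle) :
    MemLp ((F '' interior refTriangle).indicator
      fun y => g (Function.invFunOn F refTriangle y)) 2 volume := by
  have hc : ContinuousOn (fun y => g (Function.invFunOn F refTriangle y)) (F '' refTriangle) := by
    refine hg.comp hF.continuousOn_invFunOn ?_
    rintro _ ⟨x, hx, rfl⟩
    rwa [hF.invFunOn_apply hx]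
  obtain ⟨R, hR⟩ := hF.isCompact_image.exists_bound_of_continuousOn hc
  have : IsFiniteMeasure (volume.restrict (F '' refTriangle)) :=
    ⟨by simpa using hF.isCompact_image.measure_lt_top⟩
  have hm := hF.isCompact_image.measurableSet
  have h : MemLp (fun y => g (Function.invFunOn F refTriangle y)) 2
      (volume.restrict (F '' refTriangle)) :=
    MemLp.of_bound (hc.aestronglyMeasurable hm) R ((ae_restrict_iff' hm).2 (ae_of_all _ hR))
  rw [memLp_indicator_iff_restrict hF.measurableSet_image_interior]
  exact h.mono_measure (Measure.restrict_mono (image_mono interior_subset) le_rfl)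

theorem integral_indicator_image (hF : IsElementMap F) (h : Plane → ℝ) :
    ∫ y, (F '' interior refTriangle).indicator h y =
      ∫ x in refTriangle, |(jacobian F x).det| * h (F x) := by
  rw [integral_indicator hF.measurableSet_image_interior,
    integral_image_eq_integral_abs_det_fderiv_smul volume isOpen_interior.measurableSet
      (fun x hx => (hF.hasFDerivAt (interior_subset hx)).hasFDerivWithinAt)
      (hF.injOn.mono interior_subset) h, setIntegral_congr_set interior_refTriangle_ae_eq]
  simp only [det_fderiv_eq, smul_eq_mul]

end IsElementMap

/-- The curl of the covariant Piola transform of `f`. -/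
def piolaCurl (F : Plane → Plane) (f : Plane → Plane) : Plane → ℝ :=
  (F '' interior refTriangle).indicator fun y =>
    (fun x => scalarCurl f x / (jacobian F x).det) (Function.invFunOn F refTriangle y)

theorem piola_apply (F f : Plane → Plane) (i : Fin 2) (y : Plane) :
    piola F f y i = (F '' interior refTriangle).indicator (fun y =>
      (fun x => ((jacobian F x)⁻¹).transpose.mulVec (f x) i)
        (Function.invFunOn F refTriangle y)) y := by
  by_cases hy : y ∈ F '' interior refTriangle
  · rw [piola, indicator_of_mem hy, indicator_of_mem hy]
  · rw [piola, indicator_of_notMem hy, indicator_of_notMem hy]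
    rfl

theorem IsElementMap.continuousOn_inv (hF : IsElementMap F) :
    ContinuousOn (fun x => (jacobian F x)⁻¹) refTriangle := by
  simp only [Matrix.inv_def, Ring.inverse_eq_inv']
  exact (hF.continuousOn_det.inv₀ hF.det_ne_zero).smul
    ((Continuous.matrix_adjugate continuous_id).comp_continuousOn hF.continuousOn_jacobian)

theorem IsElementMap.memLp_piola (hF : IsElementMap F) {f : Plane → Plane}
    (hf : Continuous f) (i : Fin 2) : MemLp (fun y => piola F f y i) 2 volume := by
  simp only [piola_apply]
  refine hF.memLp_indicator (g := fun x => ((jacobian F x)⁻¹).transpose.mulVec (f x) i) ?_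
  have hinv := hF.continuousOn_inv
  simp only [Matrix.mulVec, dotProduct, Matrix.transpose_apply]
  refine continuousOn_finsetSum _ fun k _ => ContinuousOn.mul ?_ ?_
  · exact continuousOn_pi.1 (continuousOn_pi.1 hinv k) i
  · exact ((continuous_apply k).comp hf).continuousOn

theorem continuous_scalarCurl {f : Plane → Plane} (hf : ContDiff ℝ 1 f) :
    Continuous (scalarCurl f) := by
  have h : ∀ i, ContDiff ℝ 1 fun y => f y i := fun i => contDiff_pi.1 hf i
  exact (((h 1).continuous_fderiv one_ne_zero).clm_apply continuous_const).sub
    (((h 0).continuous_fderiv one_ne_zero).clm_apply continuous_const)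

theorem IsElementMap.memLp_piolaCurl (hF : IsElementMap F) {f : Plane → Plane}
    (hf : ContDiff ℝ 1 f) : MemLp (piolaCurl F f) 2 volume :=
  hF.memLp_indicator ((continuous_scalarCurl hf).continuousOn.div hF.continuousOn_det
    hF.det_ne_zero)

/-- Boundary term in the integration by parts on one edge of one element. -/
def edgeTerm (F f : Plane → Plane) (φ : Plane → ℝ) (j : Fin 3) : ℝ :=
  ∫ s in (0 : ℝ)..1, φ (F (edgePoint j s)) * tangentialTrace f j s

theorem fderiv_comp_single (hF : IsElementMap F) {φ : Plane → ℝ} (hφ : ContDiff ℝ 1 φ)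
    {x : Plane} (hx : x ∈ refTriangle) (j : Fin 2) :
    fderiv ℝ (φ ∘ F) x (Pi.single j 1) =
      fderiv ℝ φ (F x) (Pi.single 0 1) * jacobian F x 0 j +
        fderiv ℝ φ (F x) (Pi.single 1 1) * jacobian F x 1 j := by
  rw [fderiv_comp x (hφ.differentiable one_ne_zero _) (hF.hasFDerivAt hx).differentiableAt]
  have h : ∀ v : Plane, v = v 0 • Pi.single 0 1 + v 1 • Pi.single 1 1 := fun v => by
    ext i; fin_cases i <;> simp
  rw [ContinuousLinearMap.comp_apply, h (fderiv ℝ F x (Pi.single j 1)), map_add, map_smul,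
    map_smul]
  simp only [jacobian, Matrix.of_apply, smul_eq_mul]
  ring

/-- The algebraic core of the Piola transformation: with `g = (a, b)` the gradient of the test
function, `det J` times the cross product of `J⁻ᵀ f` and `g` is the cross product of `f` and `Jᵀ g`,
and `Jᵀ g` is the pulled-back gradient. -/
theorem cross_inv_transpose {J : Matrix (Fin 2) (Fin 2) ℝ} (hJ : J.det ≠ 0) (f : Plane)
    (a b : ℝ) :
    J.det * ((J⁻¹).transpose.mulVec f 0 * b - (J⁻¹).transpose.mulVec f 1 * a) =
      f 0 * (a * J 0 1 + b * J 1 1) - f 1 * (a * J 0 0 + b * J 1 0) := by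
  have h : ∀ i, (J⁻¹).transpose.mulVec f i =
      (J.det)⁻¹ * (J.adjugate.transpose.mulVec f i) := fun i => by
    rw [Matrix.inv_def, Ring.inverse_eq_inv', Matrix.transpose_smul, Matrix.smul_mulVec]
    rfl
  rw [h, h]
  have h0 : J.adjugate.transpose.mulVec f 0 = J 1 1 * f 0 - J 1 0 * f 1 := by
    simp [Matrix.mulVec, dotProduct, Matrix.adjugate_fin_two]; ring
  have h1 : J.adjugate.transpose.mulVec f 1 = - J 0 1 * f 0 + J 0 0 * f 1 := by
    simp [Matrix.mulVec, dotProduct, Matrix.adjugate_fin_two]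
  rw [h0, h1]
  field_simp
  ring

/-- Integration by parts for a Piola transform on one element. -/
theorem IsElementMap.integral_piolaCurl (hF : IsElementMap F) {f : Plane → Plane}
    (hf : ContDiff ℝ 1 f) {φ : Plane → ℝ} (hφ : ContDiff ℝ 1 φ) :
    ∫ y, piolaCurl F f y * φ y =
      (∫ y, (piola F f y 0 * fderiv ℝ φ y (Pi.single 1 1) -
        piola F f y 1 * fderiv ℝ φ y (Pi.single 0 1))) +
      ∑ j, detSign F * edgeSign j * edgeTerm F f φ j := by
  have hm := isClosed_refTriangle.measurableSet
  -- The change of variables contributes `|det J|`, the transformed curl `1 / det J`; only the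
  -- constant sign survives.
  have h1 : ∫ y, piolaCurl F f y * φ y =
      detSign F * ∫ x in refTriangle, scalarCurl f x * (φ ∘ F) x := by
    simp only [piolaCurl, ← indicator_mul_left]
    rw [hF.integral_indicator_image, ← integral_const_mul]
    refine setIntegral_congr_fun hm fun x hx => ?_
    have := hF.det_ne_zero x hx
    simp only [hF.invFunOn_apply hx, hF.abs_det hx, Function.comp]
    field_simp
  have h2 : ∫ y, (piola F f y 0 * fderiv ℝ φ y (Pi.single 1 1) -
        piola F f y 1 * fderiv ℝ φ y (Pi.single 0 1)) =
      detSign F * ∫ x in refTriangle, (f x 0 * fderiv ℝ (φ ∘ F) x (Pi.single 1 1) -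
        f x 1 * fderiv ℝ (φ ∘ F) x (Pi.single 0 1)) := by
    have hind : ∀ y, piola F f y 0 * fderiv ℝ φ y (Pi.single 1 1) -
          piola F f y 1 * fderiv ℝ φ y (Pi.single 0 1) =
        (F '' interior refTriangle).indicator (fun y =>
          (fun x => ((jacobian F x)⁻¹).transpose.mulVec (f x))
            (Function.invFunOn F refTriangle y) 0 * fderiv ℝ φ y (Pi.single 1 1) -
          (fun x => ((jacobian F x)⁻¹).transpose.mulVec (f x))
            (Function.invFunOn F refTriangle y) 1 * fderiv ℝ φ y (Pi.single 0 1)) y := fun y => by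
      by_cases hy : y ∈ F '' interior refTriangle
      · rw [piola, indicator_of_mem hy, indicator_of_mem hy]
      · rw [piola, indicator_of_notMem hy, indicator_of_notMem hy]
        simp
    simp only [hind]
    rw [← integral_const_mul, hF.integral_indicator_image]
    refine setIntegral_congr_fun hm fun x hx => ?_
    simp only [hF.invFunOn_apply hx, hF.abs_det hx, fderiv_comp_single hF hφ hx]
    rw [mul_assoc, cross_inv_transpose (hF.det_ne_zero x hx)]
  have key := setIntegral_curl_by_parts (f := f) (ψ := φ ∘ F)
    (fun x _ i => (contDiff_pi.1 hf i).contDiffAt)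
    (fun x hx => hφ.contDiffAt.comp x (hF.contDiffAt x hx))
  rw [h1, h2, key]
  simp only [edgeTerm, Fin.sum_univ_three, Function.comp]
  ring

/-! ### The two sides of an edge -/

/-- The cross product of two vectors of the plane. -/
def cross (u v : Plane) : ℝ := u 0 * v 1 - u 1 * v 0

/-- The vertex opposite to an edge. -/
def edgeOpp : Fin 3 → Fin 3 := ![2, 1, 0]

/-- The opposite barycentric coordinate measures the signed distance to the edge, up to scaling. No
constant appears because the reference triangle has doubled area one; `edgeSign` makes the value
positive inside. -/
theorem bary_edgeOpp (j : Fin 3) (x : Plane) :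
    bary x (edgeOpp j) =
      edgeSign j * cross (edgeTangent j) (x - refVertex (edgeStart j)) := by
  fin_cases j <;>
    simp [bary, edgeOpp, edgeSign, cross, edgeTangent, refVertex, edgeStart, edgeEnd]
  ring

theorem bary_edgePoint (j : Fin 3) (s : ℝ) (i : Fin 3) :
    bary (edgePoint j s) i =
      (if edgeStart j = i then 1 - s else 0) + if edgeEnd j = i then s else 0 := by
  fin_cases j <;> fin_cases i <;>
    simp [bary, edgePoint, refVertex, edgeStart, edgeEnd]

theorem fderiv_eq_mulVec (F : Plane → Plane) (x v : Plane) :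
    fderiv ℝ F x v = (jacobian F x).mulVec v := by
  rw [jacobian_eq_toMatrix, LinearMap.toMatrix'_mulVec]
  rfl

theorem cross_mulVec (J : Matrix (Fin 2) (Fin 2) ℝ) (u v : Plane) :
    cross (J.mulVec u) (J.mulVec v) = J.det * cross u v := by
  simp [cross, Matrix.mulVec, dotProduct, Matrix.det_fin_two]
  ring

theorem edgeTangent_ne_zero (j : Fin 3) : edgeTangent j ≠ 0 := by
  intro h
  have h0 := congrFun h 0
  have h1 := congrFun h 1
  fin_cases j <;> simp [edgeTangent, refVertex, edgeStart, edgeEnd] at h0 h1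

theorem edgeSign_eq (j : Fin 3) : edgeSign j = 1 ∨ edgeSign j = -1 := by
  fin_cases j <;> simp [edgeSign]

namespace IsElementMap

/-- Near an image of an edge point, the element map has an inverse, along which the barycentric
coordinate opposite to the edge is differentiable. -/
theorem exists_localInverse (hF : IsElementMap F) (j : Fin 3) {s : ℝ}
    (hs : s ∈ Ioo (0 : ℝ) 1) (d : Plane) :
    ∃ G : Plane → Plane, ContinuousAt G (F (edgePoint j s)) ∧
      G (F (edgePoint j s)) = edgePoint j s ∧
      (∀ᶠ x in 𝓝 (edgePoint j s), G (F x) = x) ∧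
      (∀ᶠ y in 𝓝 (F (edgePoint j s)), F (G y) = y) ∧
      HasDerivAt (fun r : ℝ => bary (G (F (edgePoint j s) + r • d)) (edgeOpp j))
        (edgeSign j * (cross (fderiv ℝ F (edgePoint j s) (edgeTangent j)) d /
          (jacobian F (edgePoint j s)).det)) 0 := by
  set x := edgePoint j s with hx
  have hxT : x ∈ refTriangle := edgePoint_mem j ⟨hs.1.le, hs.2.le⟩
  have hdet := hF.det_ne_zero x hxT
  have hdet' : (fderiv ℝ F x).det ≠ 0 := by rwa [det_fderiv_eq]
  let e := ContinuousLinearMap.toContinuousLinearEquivOfDetNeZero _ hdet'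
  have he : ∀ v, fderiv ℝ F x (e.symm v) = v := fun v => e.apply_symm_apply v
  have hstrict : HasStrictFDerivAt F (e : Plane →L[ℝ] Plane) x :=
    (hF.contDiffAt x hxT).hasStrictFDerivAt one_ne_zero
  have hG := hstrict.to_localInverse.hasFDerivAt
  set G := hstrict.localInverse F e x
  refine ⟨G, hG.continuousAt, hstrict.eventually_left_inverse.self_of_nhds,
    hstrict.eventually_left_inverse, hstrict.eventually_right_inverse, ?_⟩
  have hline : HasDerivAt (fun r : ℝ => F x + r • d) d 0 := by
    simpa using ((hasDerivAt_id' (0 : ℝ)).smul_const d).const_add (F x)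
  have hcomp : HasDerivAt (fun r : ℝ => G (F x + r • d)) (e.symm d) 0 := by
    have hG' : HasFDerivAt G (e.symm : Plane →L[ℝ] Plane) (F x + (0 : ℝ) • d) := by
      simpa using hG
    exact hG'.comp_hasDerivAt 0 hline
  have hi := fun i => hasDerivAt_pi.1 hcomp i
  -- A linear map multiplies cross products by its determinant, and `d` is the image of `e.symm d`
  -- under the derivative of `F`.
  have hcr : cross (edgeTangent j) (e.symm d) =
      cross (fderiv ℝ F x (edgeTangent j)) d / (jacobian F x).det := by
    rw [eq_div_iff hdet]
    conv_rhs => rw [← he d]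
    rw [fderiv_eq_mulVec, fderiv_eq_mulVec, cross_mulVec]
    ring
  rw [← hcr]
  simp only [bary_edgeOpp, cross, Pi.sub_apply]
  exact ((((hi 1).sub_const _).const_mul _).sub (((hi 0).sub_const _).const_mul _)).const_mul _

/-- Makes the denominator positive, so that the sign of the derivative in `exists_localInverse` can
be read off from the numerator. -/
theorem mul_div_det (hF : IsElementMap F) {x : Plane} (hx : x ∈ refTriangle) (a c : ℝ) :
    a * (c / (jacobian F x).det) = detSign F * a * c / |(jacobian F x).det| := by
  rw [hF.abs_det hx]
  have := hF.det_ne_zero x hx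
  have : detSign F ≠ 0 := by
    rcases hF.detSign_eq with h | h <;> rw [h] <;> norm_num
  field_simp

/-- Along `d` the opposite barycentric coordinate of the local inverse leaves zero with positive
derivative, while the other two are positive at an inner edge point and stay so by continuity. Hence
the local inverse stays in the triangle. -/
theorem eventually_exists_preimage (hF : IsElementMap F) (j : Fin 3) {s : ℝ}
    (hs : s ∈ Ioo (0 : ℝ) 1) (d : Plane)
    (hd : 0 < detSign F * edgeSign j *
      cross (fderiv ℝ F (edgePoint j s) (edgeTangent j)) d) :
    ∀ᶠ r : ℝ in 𝓝[>] 0, ∃ z ∈ refTriangle, F z = F (edgePoint j s) + r • d ∧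
      0 < bary z (edgeOpp j) := by
  have hxT : edgePoint j s ∈ refTriangle := edgePoint_mem j ⟨hs.1.le, hs.2.le⟩
  obtain ⟨G, hGc, hGx, -, hR, hD⟩ := hF.exists_localInverse j hs d
  rw [hF.mul_div_det hxT] at hD
  have hpos := div_pos hd (abs_pos.2 (hF.det_ne_zero _ hxT))
  have hline : Tendsto (fun r : ℝ => F (edgePoint j s) + r • d) (𝓝[>] 0)
      (𝓝 (F (edgePoint j s))) := by
    have : Continuous fun r : ℝ => F (edgePoint j s) + r • d := by fun_prop
    simpa using (this.tendsto 0).mono_left nhdsWithin_le_nhds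
  have h0 : bary (edgePoint j s) (edgeOpp j) = 0 := by
    rw [bary_edgePoint]; fin_cases j <;> simp [edgeStart, edgeEnd, edgeOpp]
  have hopp : ∀ᶠ r : ℝ in 𝓝[>] 0,
      0 < bary (G (F (edgePoint j s) + r • d)) (edgeOpp j) := by
    have h := (hasDerivAt_iff_tendsto_slope.1 hD).mono_left
      (nhdsWithin_mono (0 : ℝ) (s := Ioi 0) fun r hr => ne_of_gt hr)
    filter_upwards [h.eventually (lt_mem_nhds hpos), self_mem_nhdsWithin] with r hr hr0
    rw [slope_def_field] at hr
    simp only [zero_smul, add_zero, hGx, h0, sub_zero] at hr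
    exact (div_pos_iff_of_pos_right hr0).1 hr
  have hGt : Tendsto (fun r : ℝ => G (F (edgePoint j s) + r • d)) (𝓝[>] 0)
      (𝓝 (edgePoint j s)) := by
    have := hGc.tendsto.comp hline
    rwa [hGx] at this
  have hother : ∀ i, i ≠ edgeOpp j → ∀ᶠ r : ℝ in 𝓝[>] 0,
      0 < bary (G (F (edgePoint j s) + r • d)) i := fun i hi => by
    refine (((continuous_bary i).tendsto _).comp hGt).eventually (lt_mem_nhds ?_)
    rw [bary_edgePoint]
    obtain ⟨hs0, hs1⟩ := hs
    fin_cases j <;> fin_cases i <;> simp [edgeStart, edgeEnd, edgeOpp] at hi ⊢ <;> assumption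
  have hall : ∀ᶠ r : ℝ in 𝓝[>] 0, ∀ i, 0 < bary (G (F (edgePoint j s) + r • d)) i := by
    refine eventually_all.2 fun i => ?_
    by_cases hi : i = edgeOpp j
    · rw [hi]; exact hopp
    · exact hother i hi
  filter_upwards [hall, hline.eventually hR] with r hr hr'
  exact ⟨_, mem_refTriangle_of_bary fun i => (hr i).le, hr', hr _⟩

/-- Here the opposite coordinate of the local inverse becomes negative, whereas a preimage in the
triangle would have it nonnegative. -/
theorem eventually_notMem_image (hF : IsElementMap F) (j : Fin 3) {s : ℝ}
    (hs : s ∈ Ioo (0 : ℝ) 1) (d : Plane)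
    (hd : detSign F * edgeSign j *
      cross (fderiv ℝ F (edgePoint j s) (edgeTangent j)) d < 0) :
    ∀ᶠ r : ℝ in 𝓝[>] 0, F (edgePoint j s) + r • d ∉ F '' refTriangle := by
  have hxT : edgePoint j s ∈ refTriangle := edgePoint_mem j ⟨hs.1.le, hs.2.le⟩
  obtain ⟨G, hGc, hGx, hL, -, hD⟩ := hF.exists_localInverse j hs d
  rw [hF.mul_div_det hxT] at hD
  have hneg := div_neg_of_neg_of_pos hd (abs_pos.2 (hF.det_ne_zero _ hxT))
  have hline : Tendsto (fun r : ℝ => F (edgePoint j s) + r • d) (𝓝[>] 0)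
      (𝓝 (F (edgePoint j s))) := by
    have : Continuous fun r : ℝ => F (edgePoint j s) + r • d := by fun_prop
    simpa using (this.tendsto 0).mono_left nhdsWithin_le_nhds
  have h0 : bary (edgePoint j s) (edgeOpp j) = 0 := by
    rw [bary_edgePoint]; fin_cases j <;> simp [edgeStart, edgeEnd, edgeOpp]
  have hopp : ∀ᶠ r : ℝ in 𝓝[>] 0,
      bary (G (F (edgePoint j s) + r • d)) (edgeOpp j) < 0 := by
    have h := (hasDerivAt_iff_tendsto_slope.1 hD).mono_left
      (nhdsWithin_mono (0 : ℝ) (s := Ioi 0) fun r hr => ne_of_gt hr)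
    filter_upwards [h.eventually (gt_mem_nhds hneg), self_mem_nhdsWithin] with r hr hr0
    rw [slope_def_field] at hr
    simp only [zero_smul, add_zero, hGx, h0, sub_zero] at hr
    by_contra hn
    exact absurd hr (not_lt.2 (div_nonneg (not_lt.1 hn) (le_of_lt hr0)))
  -- A preimage in the triangle might a priori be far from the edge point. Continuity of the global
  -- inverse on the closed element forces it to be close, where it agrees with the local inverse
  -- `G`.
  have hinv := (hF.continuousOn_invFunOn _ (mem_image_of_mem F hxT)).tendsto
  rw [hF.invFunOn_apply hxT] at hinv
  have hev := eventually_nhdsWithin_iff.1 (hinv.eventually hL)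
  filter_upwards [hopp, hline.eventually hev] with r hr hr' hmem
  have hG := hr' hmem
  obtain ⟨z, hz, hzr⟩ := hmem
  rw [← hzr] at hr hG
  rw [hF.invFunOn_apply hz] at hG
  rw [hG] at hr
  exact absurd (bary_nonneg hz _) (not_le.2 hr)

theorem fderiv_edgeTangent_ne_zero (hF : IsElementMap F) {x : Plane} (hx : x ∈ refTriangle)
    (j : Fin 3) : fderiv ℝ F x (edgeTangent j) ≠ 0 := by
  rw [fderiv_eq_mulVec]
  intro h
  exact edgeTangent_ne_zero j (Matrix.eq_zero_of_mulVec_eq_zero (hF.det_ne_zero x hx) h)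

end IsElementMap

theorem exists_cross_pos {t : Plane} (ht : t ≠ 0) : ∃ d, 0 < cross t d := by
  refine ⟨![-t 1, t 0], ?_⟩
  have h : cross t ![-t 1, t 0] = t 0 * t 0 + t 1 * t 1 := by simp [cross]
  rw [h]
  by_contra hn
  refine ht (funext fun i => ?_)
  have h0 : t 0 = 0 := by nlinarith [mul_self_nonneg (t 0), mul_self_nonneg (t 1)]
  have h1 : t 1 = 0 := by nlinarith [mul_self_nonneg (t 0), mul_self_nonneg (t 1)]
  fin_cases i <;> assumption

theorem cross_neg_right (t d : Plane) : cross t (-d) = -cross t d := by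
  simp [cross]; ring

theorem exists_mul_cross_pos {t : Plane} (ht : t ≠ 0) {σ : ℝ} (hσ : σ ≠ 0) :
    ∃ d, 0 < σ * cross t d := by
  obtain ⟨d, hd⟩ := exists_cross_pos ht
  rcases lt_or_gt_of_ne hσ with h | h
  · exact ⟨-d, by rw [cross_neg_right]; nlinarith [mul_pos (neg_pos.2 h) hd]⟩
  · exact ⟨d, mul_pos h hd⟩

/-! ### Edges of a mesh -/

theorem bary_injective : Function.Injective bary := by
  intro x y h
  have h1 := congrFun h 1
  have h2 := congrFun h 2
  simp [bary] at h1 h2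
  ext i; fin_cases i <;> assumption

theorem globalBary_apply {v : Fin 3 → ℕ} (hv : Function.Injective v) (x : Plane) (i : Fin 3) :
    globalBary v x (v i) = bary x i := by
  simp [globalBary, hv.eq_iff]

theorem mem_range_of_globalBary_ne_zero {v : Fin 3 → ℕ} {x : Plane} {n : ℕ}
    (h : globalBary v x n ≠ 0) : n ∈ range v := by
  by_contra hn
  refine h (Finset.sum_eq_zero fun i _ => if_neg fun hi => hn ⟨i, hi⟩)

theorem globalBary_edgePoint (v : Fin 3 → ℕ) (j : Fin 3) (s : ℝ) (n : ℕ) :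
    globalBary v (edgePoint j s) n =
      (if v (edgeStart j) = n then 1 - s else 0) + if v (edgeEnd j) = n then s else 0 := by
  simp only [globalBary, bary_edgePoint, Fin.sum_univ_three]
  fin_cases j <;> simp [edgeStart, edgeEnd] <;> congr

theorem forall_fin_three_of_edge {P : Fin 3 → Prop} (j : Fin 3) (h0 : P (edgeStart j))
    (h1 : P (edgeEnd j)) (h2 : P (edgeOpp j)) (i : Fin 3) : P i := by
  fin_cases j <;> fin_cases i <;> assumption

theorem edgeStart_lt_edgeEnd (j : Fin 3) : edgeStart j < edgeEnd j := by
  fin_cases j <;> decide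

theorem exists_edge {k l : Fin 3} (h : k < l) : ∃ j, edgeStart j = k ∧ edgeEnd j = l := by
  revert k l; decide

theorem edge_ext {j j' : Fin 3} (h : edgeStart j = edgeStart j') (h' : edgeEnd j = edgeEnd j') :
    j = j' := by
  revert j j'; decide

namespace Mesh

variable {ι : Type*} (M : Mesh ι)

theorem isElementMap (K : ι) : IsElementMap (M.map K) where
  contDiffAt := M.contDiffAt K
  det_ne_zero := M.det_ne_zero K
  injOn := fun x hx y hy h => bary_injective <| funext fun i => by
    rw [← globalBary_apply (M.vert_injective K), ← globalBary_apply (M.vert_injective K)]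
    exact (M.conforming K K x hx y hy).1 h _

/-- The edge `j` of the element `K` leads from vertex number `n` to vertex number `m`. -/
def HasEdge (n m : ℕ) (K : ι) (j : Fin 3) : Prop :=
  M.vert K (edgeStart j) = n ∧ M.vert K (edgeEnd j) = m

/-- Orientation of an edge relative to the boundary of the element. -/
def sign (K : ι) (j : Fin 3) : ℝ := detSign (M.map K) * edgeSign j

variable {M} {n m : ℕ} {K L : ι} {j j' : Fin 3}

theorem sign_eq (M : Mesh ι) (K : ι) (j : Fin 3) : M.sign K j = 1 ∨ M.sign K j = -1 := by
  rw [sign]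
  rcases (M.isElementMap K).detSign_eq with h | h <;> rcases edgeSign_eq j with h' | h' <;>
    rw [h, h'] <;> norm_num

theorem sign_ne_zero (M : Mesh ι) (K : ι) (j : Fin 3) : M.sign K j ≠ 0 := by
  rcases M.sign_eq K j with h | h <;> rw [h] <;> norm_num

theorem HasEdge.map_edgePoint (h : M.HasEdge n m K j) (h' : M.HasEdge n m L j') {s : ℝ}
    (hs : s ∈ Icc (0 : ℝ) 1) : M.map K (edgePoint j s) = M.map L (edgePoint j' s) := by
  refine (M.conforming K L _ (edgePoint_mem j hs) _ (edgePoint_mem j' hs)).2 fun N => ?_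
  rw [globalBary_edgePoint, globalBary_edgePoint, h.1, h.2, h'.1, h'.2]

/-- Both sides are the velocity of the same curve; an inner parameter is taken so that the curves
agree in a full neighbourhood. -/
theorem HasEdge.fderiv_edgeTangent (h : M.HasEdge n m K j) (h' : M.HasEdge n m L j') {s : ℝ}
    (hs : s ∈ Ioo (0 : ℝ) 1) :
    fderiv ℝ (M.map K) (edgePoint j s) (edgeTangent j) =
      fderiv ℝ (M.map L) (edgePoint j' s) (edgeTangent j') := by
  have hd : ∀ K j, HasDerivAt (fun s => M.map K (edgePoint j s))
      (fderiv ℝ (M.map K) (edgePoint j s) (edgeTangent j)) s := fun K j =>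
    ((M.isElementMap K).hasFDerivAt (edgePoint_mem j (Ioo_subset_Icc_self hs))).comp_hasDerivAt s
      (hasDerivAt_edgePoint j s)
  refine (hd K j).unique ((hd L j').congr_of_eventuallyEq ?_)
  filter_upwards [isOpen_Ioo.mem_nhds hs] with r hr
  exact h.map_edgePoint h' (Ioo_subset_Icc_self hr)

/-- Two elements on the same side of a common edge coincide. -/
theorem HasEdge.eq_of_sign (h : M.HasEdge n m K j) (h' : M.HasEdge n m L j')
    (hσ : M.sign K j = M.sign L j') : K = L ∧ j = j' := by
  have hs : (1 / 2 : ℝ) ∈ Ioo (0 : ℝ) 1 := by constructor <;> norm_num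
  have hs' := Ioo_subset_Icc_self hs
  obtain ⟨d, hd⟩ := exists_mul_cross_pos
    ((M.isElementMap K).fderiv_edgeTangent_ne_zero (edgePoint_mem j hs') j) (M.sign_ne_zero K j)
  have hK := (M.isElementMap K).eventually_exists_preimage j hs d hd
  rw [h.fderiv_edgeTangent h' hs, hσ] at hd
  have hL := (M.isElementMap L).eventually_exists_preimage j' hs d hd
  -- Since `d` points into both elements, a small step from the midpoint of the edge lands in both,
  -- off the edge. Conformity then makes the third vertex of each a vertex of the other.
  obtain ⟨r, ⟨x, hx, hxr, hx0⟩, y, hy, hyr, hy0⟩ := (hK.and hL).exists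
  have hxy : M.map K x = M.map L y := by rw [hxr, hyr, h.map_edgePoint h' hs']
  have hb := (M.conforming K L x hx y hy).1 hxy
  have hKL : K = L := by
    refine M.eq_of_range K L (Subset.antisymm ?_ ?_)
    · rintro _ ⟨i, rfl⟩
      refine forall_fin_three_of_edge (P := fun i => M.vert K i ∈ range (M.vert L)) j ?_ ?_ ?_ i
      · exact ⟨_, h'.1.trans h.1.symm⟩
      · exact ⟨_, h'.2.trans h.2.symm⟩
      · refine mem_range_of_globalBary_ne_zero (x := y) ?_
        rw [← hb, globalBary_apply (M.vert_injective K)]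
        exact hx0.ne'
    · rintro _ ⟨i, rfl⟩
      refine forall_fin_three_of_edge (P := fun i => M.vert L i ∈ range (M.vert K)) j' ?_ ?_ ?_ i
      · exact ⟨_, h.1.trans h'.1.symm⟩
      · exact ⟨_, h.2.trans h'.2.symm⟩
      · refine mem_range_of_globalBary_ne_zero (x := x) ?_
        rw [hb, globalBary_apply (M.vert_injective L)]
        exact hy0.ne'
  subst hKL
  exact ⟨rfl, edge_ext (M.vert_injective K (h.1.trans h'.1.symm))
    (M.vert_injective K (h.2.trans h'.2.symm))⟩

/-- An element that contains an inner point of an edge has that edge. -/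
theorem HasEdge.of_mem (h : M.HasEdge n m K j) {s : ℝ} (hs : s ∈ Ioo (0 : ℝ) 1)
    (hmem : M.map K (edgePoint j s) ∈ M.map L '' refTriangle) : ∃ j', M.HasEdge n m L j' := by
  obtain ⟨y, hy, hyr⟩ := hmem
  have hb := (M.conforming K L _ (edgePoint_mem j (Ioo_subset_Icc_self hs)) y hy).1 hyr.symm
  have hne : edgeStart j ≠ edgeEnd j := (edgeStart_lt_edgeEnd j).ne
  have hstart : n ∈ range (M.vert L) := by
    refine mem_range_of_globalBary_ne_zero (x := y) ?_
    rw [← hb, ← h.1, globalBary_apply (M.vert_injective K), bary_edgePoint, if_pos rfl,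
      if_neg hne.symm, add_zero]
    exact (sub_pos.2 hs.2).ne'
  have hend : m ∈ range (M.vert L) := by
    refine mem_range_of_globalBary_ne_zero (x := y) ?_
    rw [← hb, ← h.2, globalBary_apply (M.vert_injective K), bary_edgePoint, if_pos rfl,
      if_neg hne, zero_add]
    exact hs.1.ne'
  obtain ⟨k, hk⟩ := hstart
  obtain ⟨l, hl⟩ := hend
  -- Both end points carry nonzero barycentric weight, hence are vertices of `L`; `oriented` ensures
  -- that the local edge of `L` runs the same way.
  obtain ⟨j', rfl, rfl⟩ := exists_edge (M.oriented K L _ _ k l (h.1.trans hk.symm)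
    (h.2.trans hl.symm) (edgeStart_lt_edgeEnd j))
  exact ⟨j', hk, hl⟩

/-- An edge with an inner point in the triangulated domain has elements on both sides. -/
theorem HasEdge.exists_neg_sign [Finite ι] (h : M.HasEdge n m K j) {s : ℝ}
    (hs : s ∈ Ioo (0 : ℝ) 1) (hmem : M.map K (edgePoint j s) ∈ M.domain) :
    ∃ L j', M.HasEdge n m L j' ∧ M.sign L j' = -M.sign K j := by
  by_contra! hcon
  have hs' := Ioo_subset_Icc_self hs
  -- The negated sign makes `d` point out of `K`.
  obtain ⟨d, hd⟩ := exists_mul_cross_pos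
    ((M.isElementMap K).fderiv_edgeTangent_ne_zero (edgePoint_mem j hs') j)
    (neg_ne_zero.2 (M.sign_ne_zero K j))
  have hline : Tendsto (fun r : ℝ => M.map K (edgePoint j s) + r • d) (𝓝[>] 0)
      (𝓝 (M.map K (edgePoint j s))) := by
    have : Continuous fun r : ℝ => M.map K (edgePoint j s) + r • d := by fun_prop
    simpa using (this.tendsto 0).mono_left nhdsWithin_le_nhds
  -- An element containing the point has the edge, by assumption on the same side as `K`, so the ray
  -- leaves it too; any other element is closed and misses a neighbourhood. As there are finitely
  -- many elements, the ray leaves the whole union, contradicting interiority.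
  have hout : ∀ᶠ r : ℝ in 𝓝[>] 0, ∀ L,
      M.map K (edgePoint j s) + r • d ∉ M.map L '' refTriangle := by
    refine eventually_all.2 fun L => ?_
    by_cases hL : M.map K (edgePoint j s) ∈ M.map L '' refTriangle
    · obtain ⟨j', hj'⟩ := h.of_mem hs hL
      have hsign : M.sign L j' = M.sign K j := by
        have := hcon L j' hj'
        rcases M.sign_eq L j' with h1 | h1 <;> rcases M.sign_eq K j with h2 | h2 <;>
          rw [h1, h2] at this ⊢ <;> norm_num at this
      rw [h.map_edgePoint hj' hs']
      refine (M.isElementMap L).eventually_notMem_image j' hs d ?_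
      rw [h.fderiv_edgeTangent hj' hs, neg_mul, neg_pos] at hd
      change M.sign L j' * _ < 0
      rwa [hsign]
    · exact hline.eventually ((M.isElementMap L).isCompact_image.isClosed.isOpen_compl.mem_nhds hL)
  have hin := hline.eventually (mem_interior_iff_mem_nhds.1 hmem)
  obtain ⟨r, hr, hr'⟩ := (hout.and hin).exists
  obtain ⟨L, hL⟩ := mem_iUnion.1 hr'
  exact hr L hL

end Mesh

/-! ### Tangential traces of the base functions -/

theorem contDiff_eval (n : Poly) : ContDiff ℝ 1 fun x : Plane => MvPolynomial.eval x n :=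
  (AnalyticOnNhd.eval_mvPolynomial n).contDiff.of_le le_top

theorem hasDerivAt_eval (n : Poly) {c : ℝ → Plane} {c' : Plane} {s : ℝ} (hc : HasDerivAt c c' s) :
    HasDerivAt (fun s => MvPolynomial.eval (c s) n)
      (∑ i, c' i * MvPolynomial.eval (c s) (MvPolynomial.pderiv i n)) s := by
  induction n using MvPolynomial.induction_on with
  | C a => simpa using hasDerivAt_const s a
  | add f g hf hg => simpa [mul_add, Finset.sum_add_distrib] using hf.fun_add hg
  | mul_X f i hf =>
    have h := hf.mul (hasDerivAt_pi.1 hc i)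
    simp only [map_mul, MvPolynomial.eval_X]
    refine h.congr_deriv ?_
    fin_cases i <;> simp [MvPolynomial.pderiv_X, Pi.single_apply] <;> ring

theorem hasDerivAt_edgeTrace (n : Poly) (j : Fin 3) (s : ℝ) :
    HasDerivAt (edgeTrace n j) (tangentialTrace (grad n) j s) s :=
  hasDerivAt_eval n (hasDerivAt_edgePoint j s)

/-- The tangential trace of a gradient is the derivative of the scalar trace. Derivatives within
`[0,1]` are unique, so equality extends to the end points. -/
theorem tangentialTrace_grad_congr {n n' : Poly} {j j' : Fin 3}
    (h : ∀ s ∈ Icc (0 : ℝ) 1, edgeTrace n j s = edgeTrace n' j' s) {s : ℝ}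
    (hs : s ∈ Icc (0 : ℝ) 1) :
    tangentialTrace (grad n) j s = tangentialTrace (grad n') j' s :=
  (uniqueDiffOn_Icc_zero_one s hs).eq_deriv _
    ((hasDerivAt_edgeTrace n j s).hasDerivWithinAt)
    (((hasDerivAt_edgeTrace n' j' s).hasDerivWithinAt).congr h (h s hs))

theorem tangentialTrace_grad_eq_zero {n : Poly} {j : Fin 3}
    (h : ∀ s ∈ Icc (0 : ℝ) 1, edgeTrace n j s = 0) {s : ℝ} (hs : s ∈ Icc (0 : ℝ) 1) :
    tangentialTrace (grad n) j s = 0 := by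
  rw [tangentialTrace_grad_congr (n' := 0) (j' := j) (fun s hs => (h s hs).trans (by simp [edgeTrace])) hs]
  simp [tangentialTrace, grad]

theorem tangentialTrace_lowest (i j : Fin 3) (s : ℝ) :
    tangentialTrace (lowest i) j s = if i = j then 1 else 0 := by
  fin_cases j <;> fin_cases i <;>
    simp [tangentialTrace_zero, tangentialTrace_one, tangentialTrace_two, lowest]

theorem tangentialTrace_add (f g : Plane → Plane) (j : Fin 3) (s : ℝ) :
    tangentialTrace (f + g) j s = tangentialTrace f j s + tangentialTrace g j s := by
  simp [tangentialTrace]; ring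

theorem tangentialTrace_sub (f g : Plane → Plane) (j : Fin 3) (s : ℝ) :
    tangentialTrace (f - g) j s = tangentialTrace f j s - tangentialTrace g j s := by
  simp [tangentialTrace]; ring

theorem tangentialTrace_templateProduct (n : Poly) (f : Plane → Plane) (j : Fin 3) (s : ℝ) :
    tangentialTrace (templateProduct n f) j s = edgeTrace n j s * tangentialTrace f j s := by
  simp [tangentialTrace, templateProduct, edgeTrace]; ring

theorem tangentialTrace_edgeTemplate (j : Fin 3) (s : ℝ) :
    tangentialTrace (edgeTemplate j) j s = 0 := by
  fin_cases j <;>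
    simp [edgeTemplate, tangentialTrace_add, tangentialTrace_sub, tangentialTrace_lowest]

theorem contDiff_lowest (i : Fin 3) : ContDiff ℝ 1 (lowest i) := by
  rw [contDiff_pi]
  intro k
  fin_cases i <;> fin_cases k <;> simp [lowest] <;> fun_prop

theorem contDiff_grad (n : Poly) : ContDiff ℝ 1 (grad n) :=
  contDiff_pi.2 fun _ => contDiff_eval _

theorem contDiff_templateProduct (n : Poly) {f : Plane → Plane} (hf : ContDiff ℝ 1 f) :
    ContDiff ℝ 1 (templateProduct n f) :=
  (contDiff_eval n).smul hf

variable {p : ℕ}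

theorem edgeField_contDiff (B : PolytopalBasis (p + 1)) (j : Fin 3)
    (κ : Option (Fin (p + 1 - 1))) : ContDiff ℝ 1 (edgeField B j κ) := by
  cases κ with
  | none => exact contDiff_lowest j
  | some k => exact contDiff_grad _

theorem tangentialTrace_edgeField_of_ne (B : PolytopalBasis (p + 1)) {j j' : Fin 3} (h : j ≠ j')
    (κ : Option (Fin (p + 1 - 1))) {s : ℝ} (hs : s ∈ Icc (0 : ℝ) 1) :
    tangentialTrace (edgeField B j κ) j' s = 0 := by
  cases κ with
  | none => simp [edgeField, tangentialTrace_lowest, h]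
  | some k => exact tangentialTrace_grad_eq_zero (B.edge_edge j j' k h) hs

theorem tangentialTrace_edgeField_eq (B : PolytopalBasis (p + 1)) (j j' : Fin 3)
    (κ : Option (Fin (p + 1 - 1))) {s : ℝ} (hs : s ∈ Icc (0 : ℝ) 1) :
    tangentialTrace (edgeField B j κ) j s = tangentialTrace (edgeField B j' κ) j' s := by
  cases κ with
  | none => simp [edgeField, tangentialTrace_lowest]
  | some k => exact tangentialTrace_grad_congr (B.edge_trace j j' k) hs

theorem contDiff_of_mem_templateFields {C : PolytopalBasis p} {f : Plane → Plane}
    (hf : f ∈ templateFields C) : ContDiff ℝ 1 f := by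
  have hl := contDiff_lowest
  obtain (⟨i, rfl⟩ | ⟨⟨j, k⟩, rfl⟩) | ⟨k, rfl⟩ := hf
  · refine contDiff_templateProduct _ ?_
    fin_cases i
    · exact hl 2
    · exact hl 1
  · refine contDiff_templateProduct _ ?_
    fin_cases j
    · exact (hl 2).sub (hl 1)
    · exact (hl 0).add (hl 2)
    · exact (hl 0).sub (hl 1)
  · exact contDiff_templateProduct _ (((hl 0).sub (hl 1)).add (hl 2))

/-- A vertex template has nonzero trace only on the edge opposite to its vertex, where the vertex
function vanishes. An edge template has zero trace on its own edge, and the edge function vanishes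
on the other two. A cell function vanishes on all three. -/
theorem tangentialTrace_of_mem_templateFields {C : PolytopalBasis p} {f : Plane → Plane}
    (hf : f ∈ templateFields C) (j : Fin 3) {s : ℝ} (hs : s ∈ Icc (0 : ℝ) 1) :
    tangentialTrace f j s = 0 := by
  obtain (⟨i, rfl⟩ | ⟨⟨i, k⟩, rfl⟩) | ⟨k, rfl⟩ := hf
  · simp only [tangentialTrace_templateProduct]
    fin_cases i <;> fin_cases j <;>
      simp [vertexTemplate, tangentialTrace_lowest] <;>
      exact C.vertex_edge _ _ (by decide) (by decide) s hs
  · simp only [tangentialTrace_templateProduct]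
    by_cases hij : i = j
    · rw [hij, tangentialTrace_edgeTemplate, mul_zero]
    · rw [C.edge_edge i j k hij s hs, zero_mul]
  · simp only [tangentialTrace_templateProduct]
    rw [C.cell_edge k j s hs, zero_mul]

theorem contDiff_of_mem_cellFields {B : PolytopalBasis (p + 1)} {C : 0 < p → PolytopalBasis p}
    {f : Plane → Plane} (hf : f ∈ cellFields B C) : ContDiff ℝ 1 f := by
  obtain ⟨k, rfl⟩ | ⟨hp, hf⟩ := hf
  · exact contDiff_grad _
  · exact contDiff_of_mem_templateFields hf

theorem tangentialTrace_of_mem_cellFields {B : PolytopalBasis (p + 1)}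
    {C : 0 < p → PolytopalBasis p} {f : Plane → Plane} (hf : f ∈ cellFields B C) (j : Fin 3)
    {s : ℝ} (hs : s ∈ Icc (0 : ℝ) 1) : tangentialTrace f j s = 0 := by
  obtain ⟨k, rfl⟩ | ⟨hp, hf⟩ := hf
  · exact tangentialTrace_grad_eq_zero (B.cell_edge k j) hs
  · exact tangentialTrace_of_mem_templateFields hf j hs

/-! ### Membership in `H(curl)` -/

theorem integrable_mul_test {μ : Measure Plane} [IsFiniteMeasureOnCompacts μ] {w φ : Plane → ℝ}
    (hw : MemLp w 2 μ) (hφ : Continuous φ) (hc : HasCompactSupport φ) :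
    Integrable (fun x => w x * φ x) μ :=
  hw.integrable_mul (hφ.memLp_of_hasCompactSupport (p := 2) hc)

theorem integrable_cross_grad_test {μ : Measure Plane} [IsFiniteMeasureOnCompacts μ]
    {u : Plane → Plane} {φ : Plane → ℝ} (hu : ∀ i, MemLp (fun x => u x i) 2 μ)
    (hφ : ContDiff ℝ 1 φ) (hc : HasCompactSupport φ) :
    Integrable (fun x => u x 0 * fderiv ℝ φ x (Pi.single 1 1) -
      u x 1 * fderiv ℝ φ x (Pi.single 0 1)) μ := by
  have h : ∀ i v, Integrable (fun x => u x i * fderiv ℝ φ x v) μ := fun i v =>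
    integrable_mul_test (hu i)
      ((hφ.continuous_fderiv one_ne_zero).clm_apply continuous_const) (hc.fderiv_apply ℝ v)
  exact (h 0 _).sub (h 1 _)

theorem MemHcurl.add {A : Set Plane} {u v : Plane → Plane} (hu : MemHcurl A u)
    (hv : MemHcurl A v) : MemHcurl A (u + v) := by
  obtain ⟨hu, w, hw, hwu⟩ := hu
  obtain ⟨hv, w', hw', hwv⟩ := hv
  refine ⟨fun i => (hu i).add (hv i), w + w', hw.add hw', fun φ hφ hc hs => ?_⟩
  have hφ1 : ContDiff ℝ 1 φ := hφ.of_le (mod_cast le_top)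
  have h1 := integral_add (integrable_mul_test hw hφ.continuous hc)
    (integrable_mul_test hw' hφ.continuous hc)
  have h2 := integral_add (integrable_cross_grad_test hu hφ1 hc)
    (integrable_cross_grad_test hv hφ1 hc)
  rw [← hwu φ hφ hc hs, ← hwv φ hφ hc hs, ← h1] at h2
  calc _ = _ := by simp only [Pi.add_apply, add_mul]
    _ = _ := h2.symm
    _ = _ := by
      congr 1
      ext x
      simp only [Pi.add_apply]
      ring

theorem MemHcurl.smul {A : Set Plane} {u : Plane → Plane} (c : ℝ) (hu : MemHcurl A u) :
    MemHcurl A (c • u) := by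
  obtain ⟨hu, w, hw, hwu⟩ := hu
  refine ⟨fun i => (hu i).const_smul c, c • w, hw.const_smul c, fun φ hφ hc hs => ?_⟩
  have h := congrArg (c * ·) (hwu φ hφ hc hs)
  simp only [← integral_const_mul] at h
  calc _ = _ := by simp only [Pi.smul_apply, smul_eq_mul, mul_assoc]
    _ = _ := h
    _ = _ := by
      congr 1
      ext x
      simp only [Pi.smul_apply, smul_eq_mul]
      ring

namespace Mesh

variable {ι : Type*} (M : Mesh ι)

/-- A sum of Piola transforms belongs to `H(curl)` if the boundary terms of its summands cancel. -/
theorem memHcurl_sum {κ : Type*} (S : Finset κ) (K : κ → ι) (f : κ → Plane → Plane)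
    (hf : ∀ a ∈ S, ContDiff ℝ 1 (f a))
    (h : ∀ φ : Plane → ℝ, ContDiff ℝ 1 φ → tsupport φ ⊆ M.domain →
      ∑ a ∈ S, ∑ j, M.sign (K a) j * edgeTerm (M.map (K a)) (f a) φ j = 0) :
    MemHcurl M.domain (∑ a ∈ S, piola (M.map (K a)) (f a)) := by
  have hE := fun a => M.isElementMap (K a)
  have hu : ∀ a ∈ S, ∀ i, MemLp (fun y => piola (M.map (K a)) (f a) y i) 2 volume :=
    fun a ha i => (hE a).memLp_piola (hf a ha).continuous i
  have hw : ∀ a ∈ S, MemLp (piolaCurl (M.map (K a)) (f a)) 2 volume :=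
    fun a ha => (hE a).memLp_piolaCurl (hf a ha)
  refine ⟨fun i => ?_, ∑ a ∈ S, piolaCurl (M.map (K a)) (f a), ?_, fun φ hφ hc hs => ?_⟩
  · simp only [Finset.sum_apply]
    exact (memLp_finsetSum S fun a ha => hu a ha i).restrict _
  · exact (memLp_finsetSum' S hw).restrict _
  · have hφ1 : ContDiff ℝ 1 φ := hφ.of_le (mod_cast le_top)
    have hφ0 : ∀ x, x ∉ M.domain → φ x = 0 := fun x hx =>
      image_eq_zero_of_notMem_tsupport fun hx' => hx (hs hx')
    have hφ0' : ∀ x, x ∉ M.domain → fderiv ℝ φ x = 0 := fun x hx =>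
      image_eq_zero_of_notMem_tsupport fun hx' => hx (hs (tsupport_fderiv_subset ℝ hx'))
    -- The elementwise formula integrates over the plane; the support of `φ` permits the passage
    -- from the domain.
    rw [setIntegral_eq_integral_of_forall_compl_eq_zero fun x hx => by simp [hφ0 x hx],
      setIntegral_eq_integral_of_forall_compl_eq_zero fun x hx => by simp [hφ0' x hx]]
    have hL : ∫ x, (∑ a ∈ S, piolaCurl (M.map (K a)) (f a)) x * φ x =
        ∑ a ∈ S, ∫ x, piolaCurl (M.map (K a)) (f a) x * φ x := by
      rw [← integral_finsetSum _ fun a ha => integrable_mul_test (hw a ha) hφ.continuous hc]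
      simp only [Finset.sum_apply, Finset.sum_mul]
    have hR : ∫ x, ((∑ a ∈ S, piola (M.map (K a)) (f a)) x 0 * fderiv ℝ φ x (Pi.single 1 1) -
          (∑ a ∈ S, piola (M.map (K a)) (f a)) x 1 * fderiv ℝ φ x (Pi.single 0 1)) =
        ∑ a ∈ S, ∫ x, (piola (M.map (K a)) (f a) x 0 * fderiv ℝ φ x (Pi.single 1 1) -
          piola (M.map (K a)) (f a) x 1 * fderiv ℝ φ x (Pi.single 0 1)) := by
      rw [← integral_finsetSum _ fun a ha => integrable_cross_grad_test (hu a ha) hφ1 hc]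
      simp only [Finset.sum_apply, Finset.sum_mul, Finset.sum_sub_distrib]
    rw [hL, hR, Finset.sum_congr rfl fun a ha => (hE a).integral_piolaCurl (hf a ha) hφ1,
      Finset.sum_add_distrib]
    have := h φ hφ1 hs
    simp only [sign] at this
    rw [this, add_zero]

theorem edgeTerm_eq_zero {F f : Plane → Plane} {φ : Plane → ℝ} {j : Fin 3}
    (h : ∀ s ∈ Icc (0 : ℝ) 1, tangentialTrace f j s = 0) : edgeTerm F f φ j = 0 := by
  rw [edgeTerm, intervalIntegral.integral_congr (g := fun _ => (0 : ℝ))]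
  · simp
  · intro s hs
    rw [uIcc_of_le zero_le_one] at hs
    simp [h s hs]

theorem memHcurl_of_trace_eq_zero (K : ι) {f : Plane → Plane} (hf : ContDiff ℝ 1 f)
    (h : ∀ j, ∀ s ∈ Icc (0 : ℝ) 1, tangentialTrace f j s = 0) :
    MemHcurl M.domain (piola (M.map K) f) := by
  have := M.memHcurl_sum (Finset.univ : Finset Unit) (fun _ => K) (fun _ => f) (fun _ _ => hf)
    (fun φ _ _ => Finset.sum_eq_zero fun _ _ => Finset.sum_eq_zero fun j _ => by
      rw [edgeTerm_eq_zero (h j), mul_zero])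
  simpa using this

theorem memHcurl_zero : MemHcurl M.domain 0 := by
  simpa using M.memHcurl_sum (∅ : Finset ι) id (fun _ => 0) (by simp) (by simp)

variable {M} {n m : ℕ} {K L : ι} {j j' : Fin 3}

theorem HasEdge.edgeTerm_eq (h : M.HasEdge n m K j) (h' : M.HasEdge n m L j')
    (B : PolytopalBasis (p + 1)) (κ : Option (Fin (p + 1 - 1))) (φ : Plane → ℝ) :
    edgeTerm (M.map K) (edgeField B j κ) φ j = edgeTerm (M.map L) (edgeField B j' κ) φ j' := by
  refine intervalIntegral.integral_congr fun s hs => ?_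
  rw [uIcc_of_le zero_le_one] at hs
  simp only [h.map_edgePoint h' hs, tangentialTrace_edgeField_eq B j j' κ hs]

/-- If the boundary term of an edge does not vanish, then the edge has an element on each side. -/
theorem HasEdge.exists_neg_sign_of_edgeTerm_ne_zero [Finite ι] (h : M.HasEdge n m K j)
    {f : Plane → Plane} {φ : Plane → ℝ} (hφ : tsupport φ ⊆ M.domain)
    (hne : edgeTerm (M.map K) f φ j ≠ 0) :
    ∃ L j', M.HasEdge n m L j' ∧ M.sign L j' = -M.sign K j := by
  by_contra hcon
  refine hne ?_
  have hz : ∀ s ∈ Ioo (0 : ℝ) 1,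
      φ (M.map K (edgePoint j s)) * tangentialTrace f j s = 0 := fun s hs => by
    rw [image_eq_zero_of_notMem_tsupport fun hx => hcon (h.exists_neg_sign hs (hφ hx)), zero_mul]
  -- The end points are dropped as a null set, since the two-sidedness argument applies only to
  -- inner points of the edge.
  rw [edgeTerm, intervalIntegral.integral_of_le zero_le_one, integral_Ioc_eq_integral_Ioo,
    setIntegral_congr_fun measurableSet_Ioo hz]
  simp

theorem memHcurl_edgeFunction [Fintype ι] (M : Mesh ι) (B : PolytopalBasis (p + 1)) (n m : ℕ)
    (κ : Option (Fin (p + 1 - 1))) : MemHcurl M.domain (M.edgeFunction B n m κ) := by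
  classical
  set S : Finset (ι × Fin 3) := Finset.univ.filter fun a => M.HasEdge n m a.1 a.2 with hS
  have hmem : ∀ a, a ∈ S ↔ M.HasEdge n m a.1 a.2 := fun a => by simp [hS]
  have heq : M.edgeFunction B n m κ =
      ∑ a ∈ S, piola (M.map a.1) (edgeField B a.2 κ) := by
    rw [hS, Finset.sum_filter, Fintype.sum_prod_type]
    refine Finset.sum_congr rfl fun K _ => Finset.sum_congr rfl fun j _ => ?_
    simp only [HasEdge]
    congr
  rw [heq]
  refine M.memHcurl_sum S Prod.fst (fun a => edgeField B a.2 κ)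
    (fun a _ => edgeField_contDiff B a.2 κ) fun φ _ hφ => ?_
  have hone : ∀ a ∈ S, ∑ j, M.sign a.1 j * edgeTerm (M.map a.1) (edgeField B a.2 κ) φ j =
      M.sign a.1 a.2 * edgeTerm (M.map a.1) (edgeField B a.2 κ) φ a.2 := fun a _ =>
    Finset.sum_eq_single a.2 (fun j _ hj => by
      rw [edgeTerm_eq_zero fun s hs => tangentialTrace_edgeField_of_ne B hj.symm κ hs, mul_zero])
      (by simp)
  rw [Finset.sum_congr rfl hone]
  -- A nonzero sum has a nonzero term, whose edge therefore has an element on the other side as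
  -- well. As signs are `±1` and each side holds at most one element, `S` is exactly this pair, and
  -- its two terms cancel.
  by_contra hne
  obtain ⟨a, ha, hane⟩ := Finset.exists_ne_zero_of_sum_ne_zero hne
  have hea := (hmem a).1 ha
  obtain ⟨L, j', hL, hsign⟩ :=
    hea.exists_neg_sign_of_edgeTerm_ne_zero hφ (right_ne_zero_of_mul hane)
  have hab : a ≠ (L, j') := by
    rintro rfl
    have := M.sign_ne_zero L j'
    simp only at hsign
    exact this (by linarith)
  have hSab : S = {a, (L, j')} := by
    ext b
    rw [hmem, Finset.mem_insert, Finset.mem_singleton]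
    constructor
    · intro hb
      have hcase : M.sign b.1 b.2 = M.sign a.1 a.2 ∨ M.sign b.1 b.2 = M.sign L j' := by
        rw [hsign]
        rcases M.sign_eq b.1 b.2 with h1 | h1 <;> rcases M.sign_eq a.1 a.2 with h2 | h2 <;>
          rw [h1, h2] <;> norm_num
      rcases hcase with h | h
      · obtain ⟨h1, h2⟩ := hb.eq_of_sign hea h
        exact Or.inl (Prod.ext h1 h2)
      · obtain ⟨h1, h2⟩ := hb.eq_of_sign hL h
        exact Or.inr (Prod.ext h1 h2)
    · rintro (rfl | rfl)
      · exact hea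
      · exact hL
  refine hne ?_
  rw [hSab, Finset.sum_pair hab]
  simp only [hsign, hea.edgeTerm_eq hL B κ φ]
  ring

theorem memHcurl_of_mem_nedelecI [Fintype ι] (M : Mesh ι) (B : PolytopalBasis (p + 1))
    (C : 0 < p → PolytopalBasis p) {u : Plane → Plane} (hu : u ∈ M.nedelecI B C) :
    MemHcurl M.domain u := by
  induction hu using Submodule.span_induction with
  | mem u hu =>
    obtain ⟨n, m, κ, rfl⟩ | ⟨K, f, hf, rfl⟩ := hu
    · exact M.memHcurl_edgeFunction B n m κ
    · exact M.memHcurl_of_trace_eq_zero K (contDiff_of_mem_cellFields hf)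
        fun j s hs => tangentialTrace_of_mem_cellFields hf j hs
  | zero => exact M.memHcurl_zero
  | add u v _ _ hu hv => exact hu.add hv
  | smul c u _ hu => exact hu.smul c

end Mesh

end PolytopalTemplate

end

theorem mainTheorem7 {ι : Type*} [Fintype ι] (M : PolytopalTemplate.Mesh ι) (p : ℕ)
    (B : PolytopalTemplate.PolytopalBasis (p + 1))
    (C : 0 < p → PolytopalTemplate.PolytopalBasis p) :
    (∀ f ∈ PolytopalTemplate.cellFields B C, ∀ j : Fin 3, ∀ s ∈ Set.Icc (0 : ℝ) 1,
      PolytopalTemplate.tangentialTrace f j s = 0) ∧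
    ∀ u ∈ M.nedelecI B C, PolytopalTemplate.MemHcurl M.domain u :=
  ⟨fun _ hf j _ hs => PolytopalTemplate.tangentialTrace_of_mem_cellFields hf j hs,
    fun _ hu => M.memHcurl_of_mem_nedelecI B C hu⟩
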